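/- Let $\gamma>0$ and consider the continuous-time random walk $(X(t),Y(t))_{t\ge 0}$ in the plane, started at the deterministic point $(X(0),Y(0))$, with navigation matrix $$\begin{pmatrix}-\gamma&-\gamma\\ \gamma&\gamma\end{pmatrix}.$$ That is, when the walk is at $(x,y)$, the waiting time until the next renewal is exponential with rate $x+y$; independently of this waiting time, the renewal is of the first type with probability $x/(x+y)$ and then $(-\gamma,-\gamma)$ is added to the position, and it is of the second type with probability $y/(x+y)$ and then $(\gamma,\gamma)$ is added. Assume that $\lambda:=Y(0)-X(0)>0$ and that the walk is tenable: every position that can be reached from $(X(0),Y(0))$ by finitely many renewals of positive rate has nonnegative coordinates and is not the origin. (Equivalently here, $X(0)/\gamma$ is a nonnegative integer.) Then the following hold. 1. For all $t\ge 0$ and all real $u$ with $\gamma t(e^{\gamma u}-1)<1$, the variable $e^{uX(t)}$ is integrable and $$\mathbb E\bigl[e^{uX(t)}\bigr]=\frac{1}{\bigl(1-\gamma t(e^{\gamma u}-1)\bigr)^{\lambda/\gamma}}\left(\frac{e^{\gamma u}-\gamma t(e^{\gamma u}-1)}{1-\gamma t(e^{\gamma u}-1)}\right)^{X(0)/\gamma}=\frac{\bigl(e^{\gamma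 u}-\gamma t(e^{\gamma u}-1)\bigr)^{X(0)/\gamma}}{\bigl(1-\gamma t(e^{\gamma u}-1)\bigr)^{Y(0)/\gamma}} .$$ 2. For all $t\ge 0$, $X(t)$ and $Y(t)$ are square integrable, with $\mathbb E[X(t)]=\lambda\gamma t+X(0)$, $\mathbb E[Y(t)]=\lambda\gamma t+Y(0)$ and $$\operatorname{Var}[X(t)]=\operatorname{Var}[Y(t)]=\lambda\gamma^3t^2+(2X(0)+\lambda)\gamma^2t .$$ 3. For every real $s$ with $\gamma^2 s<1$, the expectation $\mathbb E[e^{sX(t)/t}]$ is finite for all sufficiently large $t$, and $$\lim_{t\to\infty}\mathbb E\bigl[e^{sX(t)/t}\bigr]=\frac1{(1-\gamma^2 s)^{\lambda/\gamma}} .$$ 4. As $t\to\infty$, $X(t)/t$ converges in distribution to the gamma distribution with shape $\lambda/\gamma$ and scale $\gamma^2$, and so does $Y(t)/t$. -/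

import Mathlib

open MeasureTheory ProbabilityTheory Filter Topology
open scoped NNReal

namespace PolyaWalk

variable {c : ℕ}

/-- The states that the walk with navigation matrix `A` can reach from `x₀`: a renewal of colour `i`
is possible at `x` when its rate `x i` is positive, and it adds row `i` of `A` to the position. -/
inductive Reachable (A : Matrix (Fin c) (Fin c) ℝ) (x₀ : Fin c → ℝ) : (Fin c → ℝ) → Prop
  | start : Reachable A x₀ x₀
  | step {x : Fin c → ℝ} (i : Fin c) (hx : Reachable A x₀ x) (hi : 0 < x i) :
      Reachable A x₀ (x + A i)

/-- Tenability: whichever stochastic path is followed, all coordinates stay nonnegative and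
the origin is avoided. -/
def Tenable (A : Matrix (Fin c) (Fin c) ℝ) (x₀ : Fin c → ℝ) : Prop :=
  ∀ x, Reachable A x₀ x → (∀ i, 0 ≤ x i) ∧ x ≠ 0

variable {Ω : Type*}

/-- Position after the first `n` renewals, whose colours are `κ 0, …, κ (n - 1)`. -/
def position (A : Matrix (Fin c) (Fin c) ℝ) (x₀ : Fin c → ℝ) (κ : ℕ → Ω → Fin c)
    (n : ℕ) (ω : Ω) : Fin c → ℝ :=
  x₀ + ∑ k ∈ Finset.range n, A (κ k ω)

/-- Time of the `n`-th renewal (`0` for `n = 0`), the successive waiting times being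
`τ 0, τ 1, …`. -/
def renewalTime (τ : ℕ → Ω → ℝ) (n : ℕ) (ω : Ω) : ℝ :=
  ∑ k ∈ Finset.range n, τ k ω

/-- The σ-algebra generated by the first `n` waiting times and colours. -/
abbrev history (τ : ℕ → Ω → ℝ) (κ : ℕ → Ω → Fin c) (n : ℕ) : MeasurableSpace Ω :=
  ⨆ k : Fin n, MeasurableSpace.comap (fun ω => (τ k ω, κ k ω)) inferInstance

/-- `τ n` and `κ n` are the successive waiting times and colours of the renewals of the walk with
navigation matrix `A` started at `x₀`. Given the first `n` renewals, and with `z` the current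
position, the next waiting time is exponential with rate `∑ j, z j`, and, independently of it, the
next colour is `i` with probability `z i / ∑ j, z j`. -/
structure IsRenewalSequence [MeasurableSpace Ω] (P : Measure Ω)
    (A : Matrix (Fin c) (Fin c) ℝ) (x₀ : Fin c → ℝ)
    (τ : ℕ → Ω → ℝ) (κ : ℕ → Ω → Fin c) : Prop where
  measurable_waiting : ∀ n, Measurable (τ n)
  measurable_colour : ∀ n, Measurable (κ n)
  cond_law : ∀ (n : ℕ) (i : Fin c) (s : ℝ), 0 ≤ s →
    P⟦{ω | s < τ n ω ∧ κ n ω = i} | history τ κ n⟧ =ᵐ[P] fun ω =>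
      Real.exp (-(s * ∑ j, position A x₀ κ n ω j)) *
        (position A x₀ κ n ω i / ∑ j, position A x₀ κ n ω j)

/-- `X` is a continuum Pólya-like random walk with (deterministic) navigation matrix `A` and
initial position `x₀`: it sits at the `n`-th position from the `n`-th renewal until the next. -/
def IsContinuumPolyaWalk [MeasurableSpace Ω] (P : Measure Ω)
    (A : Matrix (Fin c) (Fin c) ℝ) (x₀ : Fin c → ℝ) (X : ℝ≥0 → Ω → Fin c → ℝ) : Prop :=
  ∃ (τ : ℕ → Ω → ℝ) (κ : ℕ → Ω → Fin c), IsRenewalSequence P A x₀ τ κ ∧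
    ∀ᵐ ω ∂P, ∀ (n : ℕ) (t : ℝ≥0),
      renewalTime τ n ω ≤ t → t < renewalTime τ (n + 1) ω → X t ω = position A x₀ κ n ω

end PolyaWalk

/-! Put v = e^{γu} − 1, D = 1 − γtv and N = D + v. The candidate `genFun`, which is N^{x/γ} /
D^{y/γ}, solves the backward Kolmogorov equation with initial value (1 + v)^{x/γ}
(`hasDerivAt_genFun`). Integrating that equation and conditioning on the next renewal gives a
telescoping identity (`ofReal_genFun_eq_sum_add`): the candidate at time T is the expectation over
the first n sojourns, each counted if it contains T, plus a nonnegative remainder carried by the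
event that the n-th renewal occurs by time T.

Dropping the remainder bounds E[e^{uX}] for every admissible u, hence integrability. For u < 0 the
candidate is at most 1, because Y − X is conserved and nonnegative, and the renewal times escape to
infinity because the total rate grows at most linearly; so the remainder vanishes and equality
holds. For u > 0 the candidate is unbounded in the state, and equality comes from analytic
continuation of the complex moment generating function (`complexMGF_eq`). Tenability makes X(0)/γ a
natural number, so the numerator needs no branch of a power.

Moments are derivatives at 0 of the logarithm of the closed form. The limits rest on t(e^{c/t} − 1)
→ c (`tendsto_walkTransform`), and the gamma law follows on the imaginary axis by Lévy's continuity
theorem. Results for Y follow from Y = X + λ almost surely. -/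

namespace PolyaWalk

/-! ### Joint law of the past and the next renewal. -/

section Renewal

variable {c : ℕ} {Ω : Type*}
  {A : Matrix (Fin c) (Fin c) ℝ} {x₀ : Fin c → ℝ} {τ : ℕ → Ω → ℝ} {κ : ℕ → Ω → Fin c}

lemma position_succ (A : Matrix (Fin c) (Fin c) ℝ) (x₀ : Fin c → ℝ) (κ : ℕ → Ω → Fin c)
    (n : ℕ) (ω : Ω) : position A x₀ κ (n + 1) ω = position A x₀ κ n ω + A (κ n ω) := by
  simp [position, Finset.sum_range_succ, add_assoc]

lemma renewalTime_succ (τ : ℕ → Ω → ℝ) (n : ℕ) (ω : Ω) :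
    renewalTime τ (n + 1) ω = renewalTime τ n ω + τ n ω := by
  simp [renewalTime, Finset.sum_range_succ]

lemma measurable_history_pair (τ : ℕ → Ω → ℝ) (κ : ℕ → Ω → Fin c) {n k : ℕ} (hk : k < n) :
    Measurable[history τ κ n] fun ω => (τ k ω, κ k ω) :=
  (comap_measurable _).mono
    (le_iSup (fun k : Fin n => MeasurableSpace.comap (fun ω => (τ k ω, κ k ω)) inferInstance)
      ⟨k, hk⟩) le_rfl

lemma measurable_history_renewalTime (τ : ℕ → Ω → ℝ) (κ : ℕ → Ω → Fin c) (n : ℕ) :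
    Measurable[history τ κ n] (renewalTime τ n) := by
  unfold renewalTime
  refine Finset.measurable_fun_sum _ fun k hk => ?_
  exact measurable_fst.comp (measurable_history_pair τ κ (Finset.mem_range.1 hk))

lemma measurable_history_position (A : Matrix (Fin c) (Fin c) ℝ) (x₀ : Fin c → ℝ)
    (τ : ℕ → Ω → ℝ) (κ : ℕ → Ω → Fin c) (n : ℕ) :
    Measurable[history τ κ n] (position A x₀ κ n) := by
  unfold position
  refine Measurable.const_add (Finset.measurable_fun_sum _ fun k hk => ?_) _
  exact (measurable_of_finite A).comp
    (measurable_snd.comp (measurable_history_pair τ κ (Finset.mem_range.1 hk)))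

variable [MeasurableSpace Ω] {P : Measure Ω}

lemma IsRenewalSequence.history_le (h : IsRenewalSequence P A x₀ τ κ) (n : ℕ) :
    history τ κ n ≤ ‹MeasurableSpace Ω› :=
  iSup_le fun k =>
    ((h.measurable_waiting k).prodMk (h.measurable_colour k)).comap_le

lemma IsRenewalSequence.measurable_renewalTime (h : IsRenewalSequence P A x₀ τ κ) (n : ℕ) :
    Measurable (renewalTime τ n) :=
  (measurable_history_renewalTime τ κ n).mono (h.history_le n) le_rfl

lemma IsRenewalSequence.measurable_position (h : IsRenewalSequence P A x₀ τ κ) (n : ℕ) :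
    Measurable (position A x₀ κ n) :=
  (measurable_history_position A x₀ τ κ n).mono (h.history_le n) le_rfl

lemma IsRenewalSequence.measurableSet_waiting_colour (h : IsRenewalSequence P A x₀ τ κ)
    (n : ℕ) (i : Fin c) (s : ℝ) : MeasurableSet {ω | s < τ n ω ∧ κ n ω = i} :=
  (measurableSet_lt measurable_const (h.measurable_waiting n)).inter
    (h.measurable_colour n (measurableSet_singleton i))

/-- The conditional law of the next renewal, integrated over an event of the past. -/
lemma IsRenewalSequence.measure_inter_eq [IsProbabilityMeasure P]
    (h : IsRenewalSequence P A x₀ τ κ) (n : ℕ) (i : Fin c) {s : ℝ} (hs : 0 ≤ s) {S : Set Ω}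
    (hS : MeasurableSet[history τ κ n] S) :
    P (S ∩ {ω | s < τ n ω ∧ κ n ω = i}) = ∫⁻ ω in S, ENNReal.ofReal
      (Real.exp (-(s * ∑ j, position A x₀ κ n ω j)) *
        (position A x₀ κ n ω i / ∑ j, position A x₀ κ n ω j)) ∂P := by
  have hB := h.measurableSet_waiting_colour n i s
  have hS' := h.history_le n _ hS
  have hint : Integrable ({ω | s < τ n ω ∧ κ n ω = i}.indicator fun _ => (1 : ℝ)) P :=
    (integrable_const _).indicator hB
  have hlaw := h.cond_law n i s hs
  have hnonneg : 0 ≤ᵐ[P] P⟦{ω | s < τ n ω ∧ κ n ω = i} | history τ κ n⟧ :=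
    condExp_nonneg (ae_of_all _ fun ω => Set.indicator_nonneg (fun _ _ => zero_le_one) ω)
  have key := setIntegral_condExp (h.history_le n) hint hS
  rw [integral_indicator hB, setIntegral_const, smul_eq_mul, mul_one, measureReal_def,
    Measure.restrict_apply hB, Set.inter_comm] at key
  have hcongr := lintegral_congr_ae (ae_restrict_of_ae (s := S)
    (hlaw.mono fun ω hω => congrArg ENNReal.ofReal hω))
  rw [← hcongr, ← ofReal_integral_eq_lintegral_ofReal integrable_condExp.integrableOn
    (ae_restrict_of_ae hnonneg), key, ENNReal.ofReal_toReal (measure_ne_top _ _)]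

/-- At s = 0 the conditional probabilities of the colours sum to one, so no mass is left for a
nonpositive waiting time. -/
lemma IsRenewalSequence.ae_waiting_pos_of_nonneg [IsProbabilityMeasure P]
    (h : IsRenewalSequence P A x₀ τ κ) (n : ℕ)
    (hz : ∀ᵐ ω ∂P, (∀ i, 0 ≤ position A x₀ κ n ω i) ∧ 0 < ∑ j, position A x₀ κ n ω j) :
    ∀ᵐ ω ∂P, 0 < τ n ω := by
  have hm : MeasurableSet {ω | 0 < τ n ω} :=
    measurableSet_lt measurable_const (h.measurable_waiting n)
  have hU : {ω | 0 < τ n ω} = ⋃ i, {ω | 0 < τ n ω ∧ κ n ω = i} := by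
    ext ω; simp
  have h1 : P {ω | 0 < τ n ω} = 1 := by
    rw [hU, measure_iUnion, tsum_fintype]
    · have hi : ∀ i, P {ω | 0 < τ n ω ∧ κ n ω = i} = ∫⁻ ω, ENNReal.ofReal
          (position A x₀ κ n ω i / ∑ j, position A x₀ κ n ω j) ∂P := fun i => by
        simpa using h.measure_inter_eq n i le_rfl (S := Set.univ) MeasurableSet.univ
      simp_rw [hi]
      rw [← lintegral_finsetSum']
      · rw [← measure_univ (μ := P), ← lintegral_one]
        refine lintegral_congr_ae (hz.mono fun ω hω => ?_)
        simp only
        rw [← ENNReal.ofReal_sum_of_nonneg fun i _ => div_nonneg (hω.1 i) hω.2.le,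
          ← Finset.sum_div, div_self hω.2.ne', ENNReal.ofReal_one]
      · intro i _
        have := h.measurable_position n
        have h2 : ∀ j, Measurable fun ω => position A x₀ κ n ω j :=
          fun j => (measurable_pi_apply j).comp this
        exact (((h2 i).div (Finset.measurable_fun_sum _ fun j _ => h2 j)).ennreal_ofReal).aemeasurable
    · intro i j hij
      refine Set.disjoint_left.2 fun ω hi hj => hij (hi.2.symm.trans hj.2)
    · exact fun i => h.measurableSet_waiting_colour n i 0
  exact (mem_ae_iff_prob_eq_one hm).2 h1

lemma Tenable.nonneg_and_sum_pos (hten : Tenable A x₀) {x : Fin c → ℝ} (hx : Reachable A x₀ x) :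
    (∀ i, 0 ≤ x i) ∧ 0 < ∑ j, x j := by
  obtain ⟨h0, hne⟩ := hten x hx
  refine ⟨h0, (Finset.sum_nonneg fun i _ => h0 i).lt_of_ne fun hs => hne ?_⟩
  funext i
  exact (Finset.sum_eq_zero_iff_of_nonneg fun i _ => h0 i).1 hs.symm i (Finset.mem_univ i)

/-- A colour of rate zero has conditional probability zero, so almost surely every renewal is an
admissible step. This transfers tenability, a statement about deterministic paths, to the random
positions. -/
lemma IsRenewalSequence.ae_reachable [IsProbabilityMeasure P]
    (h : IsRenewalSequence P A x₀ τ κ) (hten : Tenable A x₀) (n : ℕ) :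
    ∀ᵐ ω ∂P, Reachable A x₀ (position A x₀ κ n ω) := by
  induction n with
  | zero => exact ae_of_all _ fun ω => by simpa [position] using Reachable.start
  | succ n ih =>
    have hz := ih.mono fun ω hω => hten.nonneg_and_sum_pos hω
    have hτ := h.ae_waiting_pos_of_nonneg n hz
    -- The conditional law only speaks of colours jointly with a tail of the waiting time, hence the
    -- conjunct `0 < τ n ω`, which `hτ` discharges.
    have hpos : ∀ᵐ ω ∂P, ∀ i, ¬ (position A x₀ κ n ω i ≤ 0 ∧ 0 < τ n ω ∧ κ n ω = i) := by
      rw [ae_all_iff]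
      intro i
      have hS : MeasurableSet[history τ κ n] {ω | position A x₀ κ n ω i ≤ 0} :=
        ((measurable_pi_apply i).comp (measurable_history_position A x₀ τ κ n)) measurableSet_Iic
      have h0 := h.measure_inter_eq n i le_rfl hS
      have h1 : ∫⁻ ω in {ω | position A x₀ κ n ω i ≤ 0}, ENNReal.ofReal
          (Real.exp (-(0 * ∑ j, position A x₀ κ n ω j)) *
            (position A x₀ κ n ω i / ∑ j, position A x₀ κ n ω j)) ∂P = 0 := by
        rw [← lintegral_zero (μ := P.restrict {ω | position A x₀ κ n ω i ≤ 0})]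
        refine lintegral_congr_ae ?_
        filter_upwards [ae_restrict_of_ae hz, ae_restrict_mem (h.history_le n _ hS)] with ω hω hi
        rw [le_antisymm hi (hω.1 i)]
        simp
      rw [h1] at h0
      exact measure_eq_zero_iff_ae_notMem.1 h0
    filter_upwards [ih, hτ, hpos] with ω h1 h2 h3
    rw [position_succ]
    refine h1.step _ ?_
    by_contra hle
    exact h3 (κ n ω) ⟨not_lt.1 hle, h2, rfl⟩

lemma IsRenewalSequence.ae_nonneg_and_sum_pos [IsProbabilityMeasure P]
    (h : IsRenewalSequence P A x₀ τ κ) (hten : Tenable A x₀) (n : ℕ) :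
    ∀ᵐ ω ∂P, (∀ i, 0 ≤ position A x₀ κ n ω i) ∧ 0 < ∑ j, position A x₀ κ n ω j :=
  (h.ae_reachable hten n).mono fun _ hω => hten.nonneg_and_sum_pos hω

lemma IsRenewalSequence.ae_waiting_pos [IsProbabilityMeasure P]
    (h : IsRenewalSequence P A x₀ τ κ) (hten : Tenable A x₀) (n : ℕ) : ∀ᵐ ω ∂P, 0 < τ n ω :=
  h.ae_waiting_pos_of_nonneg n (h.ae_nonneg_and_sum_pos hten n)

/-- Density of the next waiting time and colour `i` at the position `z`. -/
noncomputable def jumpDensity (z : Fin c → ℝ) (i : Fin c) (s : ℝ) : ENNReal :=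
  ENNReal.ofReal (z i * Real.exp (-(s * ∑ j, z j)))

lemma measurable_jumpDensity (i : Fin c) :
    Measurable fun p : (ℝ × (Fin c → ℝ)) × ℝ => jumpDensity p.1.2 i p.2 := by
  unfold jumpDensity
  fun_prop

lemma lintegral_Ioi_jumpDensity {z : Fin c → ℝ} (i : Fin c) (hi : 0 ≤ z i) (hz : 0 < ∑ j, z j)
    (a : ℝ) : ∫⁻ s in Set.Ioi a, jumpDensity z i s =
      ENNReal.ofReal (Real.exp (-(a * ∑ j, z j)) * (z i / ∑ j, z j)) := by
  have hexp : ∀ s, -(s * ∑ j, z j) = (-∑ j, z j) * s := fun s => by ring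
  unfold jumpDensity
  simp_rw [hexp]
  rw [← ofReal_integral_eq_lintegral_ofReal]
  · rw [integral_const_mul, integral_exp_mul_Ioi (by linarith)]
    congr 1
    field_simp
  · exact (integrableOn_exp_mul_Ioi (by linarith) a).const_mul _
  · exact ae_of_all _ fun s => by positivity

/-- Joint law of the past and the next waiting time on the event that the next colour is `i`. -/
lemma IsRenewalSequence.map_restrict_eq [IsProbabilityMeasure P]
    (h : IsRenewalSequence P A x₀ τ κ) (hten : Tenable A x₀) (n : ℕ) (i : Fin c) :
    (P.restrict {ω | κ n ω = i}).map
        (fun ω => ((renewalTime τ n ω, position A x₀ κ n ω), τ n ω)) =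
      ((P.map fun ω => (renewalTime τ n ω, position A x₀ κ n ω)).prod
        (volume.restrict (Set.Ioi 0))).withDensity fun p => jumpDensity p.1.2 i p.2 := by
  have hV : Measurable fun ω => (renewalTime τ n ω, position A x₀ κ n ω) :=
    (h.measurable_renewalTime n).prodMk (h.measurable_position n)
  have hVτ : Measurable fun ω => ((renewalTime τ n ω, position A x₀ κ n ω), τ n ω) :=
    hV.prodMk (h.measurable_waiting n)
  have hVh : Measurable[history τ κ n] fun ω => (renewalTime τ n ω, position A x₀ κ n ω) :=
    (measurable_history_renewalTime τ κ n).prodMk (measurable_history_position A x₀ τ κ n)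
  set μ := (P.restrict {ω | κ n ω = i}).map
        (fun ω => ((renewalTime τ n ω, position A x₀ κ n ω), τ n ω)) with hμ
  set ν := ((P.map fun ω => (renewalTime τ n ω, position A x₀ κ n ω)).prod
        (volume.restrict (Set.Ioi 0))).withDensity fun p => jumpDensity p.1.2 i p.2 with hν
  have hκ : MeasurableSet {ω | κ n ω = i} := h.measurable_colour n (measurableSet_singleton i)
  have : IsFiniteMeasure μ := by rw [hμ]; infer_instance
  have hz := h.ae_nonneg_and_sum_pos hten n
  have hτ := h.ae_waiting_pos hten n
  have hμpos : ∀ᵐ p ∂μ, 0 < p.2 := by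
    rw [hμ, ae_map_iff hVτ.aemeasurable (measurableSet_lt measurable_const measurable_snd)]
    exact ae_restrict_of_ae hτ
  have hνpos : ∀ᵐ p ∂ν, 0 < p.2 := by
    refine (withDensity_absolutelyContinuous _ _).ae_le ?_
    exact Measure.quasiMeasurePreserving_snd.ae (ae_restrict_mem measurableSet_Ioi)
  have key : ∀ (S : Set (ℝ × (Fin c → ℝ))), MeasurableSet S → ∀ a : ℝ, 0 ≤ a →
      μ (S ×ˢ Set.Ioi a) = ν (S ×ˢ Set.Ioi a) := by
    intro S hS a ha
    have hSa : MeasurableSet (S ×ˢ Set.Ioi a) := hS.prod measurableSet_Ioi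
    rw [hμ, Measure.map_apply hVτ hSa, Measure.restrict_apply (hVτ hSa), hν,
      withDensity_apply _ hSa, ← Measure.prod_restrict,
      lintegral_prod _ (measurable_jumpDensity i).aemeasurable,
      Measure.restrict_restrict measurableSet_Ioi,
      Set.inter_eq_self_of_subset_left (Set.Ioi_subset_Ioi ha),
      setLIntegral_map hS _ hV]
    · have := h.measure_inter_eq n i ha (hVh hS)
      refine Eq.trans ?_ (this.trans (lintegral_congr_ae ?_))
      · congr 1
        ext ω
        simp only [Set.mem_inter_iff, Set.mem_preimage, Set.mem_prod, Set.mem_Ioi,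
          Set.mem_ofPred_eq, and_assoc]
      · filter_upwards [ae_restrict_of_ae hz] with ω hω
        rw [lintegral_Ioi_jumpDensity i (hω.1 i) hω.2]
    · exact (measurable_jumpDensity i).lintegral_prod_right'
  -- The law is known for a ≥ 0 only, while the generating π-system uses all rays. Both measures
  -- live on positive times, so a negative endpoint can be raised to 0.
  have hmax : ∀ (ρ : Measure ((ℝ × (Fin c → ℝ)) × ℝ)), (∀ᵐ p ∂ρ, 0 < p.2) →
      ∀ S a, ρ (S ×ˢ Set.Ioi a) = ρ (S ×ˢ Set.Ioi (max a 0)) := by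
    intro ρ hρ S a
    refine measure_congr (hρ.mono fun p hp => ?_)
    refine propext ?_
    change p ∈ S ×ˢ Set.Ioi a ↔ p ∈ S ×ˢ Set.Ioi (max a 0)
    simp [Set.mem_prod, hp]
  refine ext_of_generate_finite
    (Set.image2 (· ×ˢ ·) {S : Set (ℝ × (Fin c → ℝ)) | MeasurableSet S} (Set.range Set.Ioi))
    (generateFrom_eq_prod MeasurableSpace.generateFrom_measurableSet ?_
      isCountablySpanning_measurableSet ?_).symm
    (MeasurableSpace.isPiSystem_measurableSet.prod ?_) ?_ ?_
  · rw [BorelSpace.measurable_eq (α := ℝ), borel_eq_generateFrom_Ioi]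
  · refine ⟨fun k : ℕ => Set.Ioi (-(k : ℝ)), fun k => ⟨_, rfl⟩, ?_⟩
    refine Set.eq_univ_of_forall fun x => Set.mem_iUnion.2 ?_
    obtain ⟨k, hk⟩ := exists_nat_gt (-x)
    exact ⟨k, by simpa using neg_lt.1 hk⟩
  · exact isPiSystem_Ioi
  · rintro _ ⟨S, hS, _, ⟨a, rfl⟩, rfl⟩
    change μ (S ×ˢ Set.Ioi a) = ν (S ×ˢ Set.Ioi a)
    rw [hmax μ hμpos, hmax ν hνpos]
    exact key S hS _ (le_max_right _ _)
  · have huniv : ∀ (ρ : Measure ((ℝ × (Fin c → ℝ)) × ℝ)), (∀ᵐ p ∂ρ, 0 < p.2) →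
        ρ Set.univ = ρ (Set.univ ×ˢ Set.Ioi 0) := by
      intro ρ hρ
      refine measure_congr (hρ.mono fun p hp => propext ?_)
      change p ∈ Set.univ ↔ p ∈ Set.univ ×ˢ Set.Ioi 0
      simp [Set.mem_prod, hp]
    rw [huniv μ hμpos, huniv ν hνpos]
    exact key _ MeasurableSet.univ 0 le_rfl

/-- Expectations of functions of the past and of the next renewal. -/
theorem IsRenewalSequence.lintegral_next [IsProbabilityMeasure P]
    (h : IsRenewalSequence P A x₀ τ κ) (hten : Tenable A x₀) (n : ℕ)
    (f : ℝ × (Fin c → ℝ) → ℝ → Fin c → ENNReal)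
    (hf : ∀ i, Measurable fun p : (ℝ × (Fin c → ℝ)) × ℝ => f p.1 p.2 i) :
    ∫⁻ ω, f (renewalTime τ n ω, position A x₀ κ n ω) (τ n ω) (κ n ω) ∂P =
      ∫⁻ ω, (∑ i, ∫⁻ s in Set.Ioi 0, jumpDensity (position A x₀ κ n ω) i s *
        f (renewalTime τ n ω, position A x₀ κ n ω) s i) ∂P := by
  have hV : Measurable fun ω => (renewalTime τ n ω, position A x₀ κ n ω) :=
    (h.measurable_renewalTime n).prodMk (h.measurable_position n)
  have hVτ : Measurable fun ω => ((renewalTime τ n ω, position A x₀ κ n ω), τ n ω) :=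
    hV.prodMk (h.measurable_waiting n)
  have hκ : ∀ i, MeasurableSet {ω | κ n ω = i} :=
    fun i => h.measurable_colour n (measurableSet_singleton i)
  have hprod : ∀ i, Measurable fun p : (ℝ × (Fin c → ℝ)) × ℝ =>
      jumpDensity p.1.2 i p.2 * f p.1 p.2 i := fun i => (measurable_jumpDensity i).mul (hf i)
  have hsplit : ∀ ω, f (renewalTime τ n ω, position A x₀ κ n ω) (τ n ω) (κ n ω) =
      ∑ i, {ω | κ n ω = i}.indicator
        (fun ω => f (renewalTime τ n ω, position A x₀ κ n ω) (τ n ω) i) ω := by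
    intro ω
    simp [Set.indicator_apply]
  have hind : ∀ i, Measurable ({ω | κ n ω = i}.indicator
      fun ω => f (renewalTime τ n ω, position A x₀ κ n ω) (τ n ω) i) :=
    fun i => ((hf i).comp hVτ).indicator (hκ i)
  simp_rw [hsplit]
  rw [lintegral_finsetSum _ fun i _ => hind i, lintegral_finsetSum]
  · refine Finset.sum_congr rfl fun i _ => ?_
    rw [lintegral_indicator (hκ i)]
    have h1 := lintegral_map (μ := P.restrict {ω | κ n ω = i}) (hf i) hVτ
    rw [h.map_restrict_eq hten n i,
      lintegral_withDensity_eq_lintegral_mul _ (measurable_jumpDensity i) (hf i)] at h1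
    simp only [Pi.mul_apply] at h1
    rw [lintegral_prod _ (hprod i).aemeasurable,
      lintegral_map (hprod i).lintegral_prod_right' hV] at h1
    exact h1.symm
  · exact fun i _ => (hprod i).lintegral_prod_right'.comp hV

end Renewal

/-! ### Non-explosion under linearly growing rates. -/

section Explosion

variable {c : ℕ} {Ω : Type*} [MeasurableSpace Ω] {P : Measure Ω} [IsProbabilityMeasure P]
  {A : Matrix (Fin c) (Fin c) ℝ} {x₀ : Fin c → ℝ} {τ : ℕ → Ω → ℝ} {κ : ℕ → Ω → Fin c}

omit [MeasurableSpace Ω] in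
lemma sum_position_le {C : ℝ} (hC : ∀ i, ∑ j, A i j ≤ C) (κ : ℕ → Ω → Fin c) (n : ℕ) (ω : Ω) :
    ∑ j, position A x₀ κ n ω j ≤ ∑ j, x₀ j + C * n := by
  induction n with
  | zero => simp [position]
  | succ n ih =>
    rw [position_succ]
    simp only [Pi.add_apply, Finset.sum_add_distrib]
    have := hC (κ n ω)
    push_cast
    linarith

lemma sum_lintegral_jumpDensity_mul_exp {z : Fin c → ℝ} (hz0 : ∀ i, 0 ≤ z i)
    (hz : 0 < ∑ j, z j) {C : ℝ} (hC : 0 < C) (r : ℝ) :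
    ∑ i, ∫⁻ s in Set.Ioi 0, jumpDensity z i s * ENNReal.ofReal (Real.exp (-(C * (r + s)))) =
      ENNReal.ofReal ((∑ j, z j) / (∑ j, z j + C)) * ENNReal.ofReal (Real.exp (-(C * r))) := by
  have h1 : ∀ i, ∫⁻ s in Set.Ioi 0, jumpDensity z i s *
      ENNReal.ofReal (Real.exp (-(C * (r + s)))) =
      ENNReal.ofReal (z i / (∑ j, z j + C) * Real.exp (-(C * r))) := by
    intro i
    have h2 : ∀ s, jumpDensity z i s * ENNReal.ofReal (Real.exp (-(C * (r + s)))) =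
        ENNReal.ofReal (z i * Real.exp (-(C * r)) * Real.exp (-(∑ j, z j + C) * s)) := by
      intro s
      have := hz0 i
      rw [jumpDensity, ← ENNReal.ofReal_mul (by positivity), mul_assoc, ← Real.exp_add,
        mul_assoc, ← Real.exp_add]
      ring_nf
    simp_rw [h2]
    rw [← ofReal_integral_eq_lintegral_ofReal, integral_const_mul,
      integral_exp_mul_Ioi (by linarith)]
    · congr 1
      have hne : -(∑ j, z j + C) ≠ 0 := by linarith
      rw [mul_zero, Real.exp_zero]
      field_simp
    · exact (integrableOn_exp_mul_Ioi (by linarith) 0).const_mul _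
    · exact ae_of_all _ fun s => by have := hz0 i; positivity
  simp_rw [h1]
  rw [← ENNReal.ofReal_sum_of_nonneg, ← Finset.sum_mul, ← Finset.sum_div,
    ENNReal.ofReal_mul (by positivity)]
  exact fun i _ => by have := hz0 i; positivity

/-- An exponential waiting time of rate R contributes a factor R/(R + C), increasing in R, and R is
at most its initial value plus Cn. With the discount rate equal to the growth constant C, the
product of these bounds telescopes. -/
lemma IsRenewalSequence.lintegral_exp_neg_renewalTime_le (h : IsRenewalSequence P A x₀ τ κ)
    (hten : Tenable A x₀) {C : ℝ} (hC0 : 0 < C) (hC : ∀ i, ∑ j, A i j ≤ C) (n : ℕ) :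
    ∫⁻ ω, ENNReal.ofReal (Real.exp (-(C * renewalTime τ n ω))) ∂P ≤
      ENNReal.ofReal ((∑ j, x₀ j) / (∑ j, x₀ j + C * n)) := by
  have hR : 0 < ∑ j, x₀ j := (hten.nonneg_and_sum_pos .start).2
  induction n with
  | zero => simp [renewalTime, hR.ne']
  | succ n ih =>
    have h1 := h.lintegral_next hten n
      (fun p s _ => ENNReal.ofReal (Real.exp (-(C * (p.1 + s))))) (fun i => by fun_prop)
    simp only at h1
    simp_rw [renewalTime_succ]
    rw [h1]
    calc _ ≤ ∫⁻ ω, ENNReal.ofReal ((∑ j, x₀ j + C * n) / (∑ j, x₀ j + C * (n + 1))) *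
          ENNReal.ofReal (Real.exp (-(C * renewalTime τ n ω))) ∂P := by
          refine lintegral_mono_ae ?_
          filter_upwards [h.ae_nonneg_and_sum_pos hten n] with ω hω
          rw [sum_lintegral_jumpDensity_mul_exp hω.1 hω.2 hC0]
          refine mul_le_mul_left (ENNReal.ofReal_le_ofReal ?_) _
          have hle := sum_position_le (x₀ := x₀) hC κ n ω
          have hpos := hω.2
          have hn : 0 ≤ C * n := by positivity
          rw [div_le_div_iff₀ (by linarith) (by linarith)]
          nlinarith
      _ = ENNReal.ofReal ((∑ j, x₀ j + C * n) / (∑ j, x₀ j + C * (n + 1))) *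
          ∫⁻ ω, ENNReal.ofReal (Real.exp (-(C * renewalTime τ n ω))) ∂P := by
          rw [lintegral_const_mul]
          have := h.measurable_renewalTime n
          fun_prop
      _ ≤ ENNReal.ofReal ((∑ j, x₀ j + C * n) / (∑ j, x₀ j + C * (n + 1))) *
          ENNReal.ofReal ((∑ j, x₀ j) / (∑ j, x₀ j + C * n)) := by gcongr
      _ = _ := by
          rw [← ENNReal.ofReal_mul (by positivity)]
          congr 1
          push_cast
          field_simp

/-- With at most linearly growing rates, the renewal times escape to infinity. -/
lemma IsRenewalSequence.tendsto_measure_renewalTime_le (h : IsRenewalSequence P A x₀ τ κ)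
    (hten : Tenable A x₀) {C : ℝ} (hC0 : 0 < C) (hC : ∀ i, ∑ j, A i j ≤ C) (T : ℝ) :
    Tendsto (fun n => P {ω | renewalTime τ n ω ≤ T}) atTop (𝓝 0) := by
  have hbound : ∀ n : ℕ, P {ω | renewalTime τ n ω ≤ T} ≤
      ENNReal.ofReal (Real.exp (C * T) * ((∑ j, x₀ j) / (∑ j, x₀ j + C * n))) := by
    intro n
    have hm : Measurable (renewalTime τ n) := h.measurable_renewalTime n
    -- Markov's inequality for exp(C(T − renewal time)).
    calc P {ω | renewalTime τ n ω ≤ T}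
        ≤ P {ω | (1 : ENNReal) ≤ ENNReal.ofReal (Real.exp (C * T)) *
          ENNReal.ofReal (Real.exp (-(C * renewalTime τ n ω)))} := by
          refine measure_mono fun ω (hω : renewalTime τ n ω ≤ T) => ?_
          change (1 : ENNReal) ≤ _
          rw [← ENNReal.ofReal_mul (Real.exp_pos _).le, ← Real.exp_add, ENNReal.one_le_ofReal]
          refine Real.one_le_exp ?_
          nlinarith
      _ ≤ (∫⁻ ω, ENNReal.ofReal (Real.exp (C * T)) *
          ENNReal.ofReal (Real.exp (-(C * renewalTime τ n ω))) ∂P) / 1 :=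
          meas_ge_le_lintegral_div (by fun_prop) one_ne_zero ENNReal.one_ne_top
      _ ≤ _ := by
          rw [div_one, lintegral_const_mul _ (by fun_prop),
            ENNReal.ofReal_mul (Real.exp_pos _).le]
          gcongr
          exact h.lintegral_exp_neg_renewalTime_le hten hC0 hC n
  refine tendsto_of_tendsto_of_tendsto_of_le_of_le tendsto_const_nhds ?_
    (fun _ => zero_le) hbound
  rw [← ENNReal.ofReal_zero]
  refine ENNReal.tendsto_ofReal ?_
  rw [← mul_zero (Real.exp (C * T))]
  refine Tendsto.const_mul _ (Tendsto.const_div_atTop ?_ _)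
  exact tendsto_atTop_add_const_left _ _ (tendsto_natCast_atTop_atTop.const_mul_atTop hC0)

lemma IsRenewalSequence.ae_exists_lt_renewalTime (h : IsRenewalSequence P A x₀ τ κ)
    (hten : Tenable A x₀) {C : ℝ} (hC0 : 0 < C) (hC : ∀ i, ∑ j, A i j ≤ C) (T : ℝ) :
    ∀ᵐ ω ∂P, ∃ n, T < renewalTime τ n ω := by
  rw [ae_iff]
  refine le_antisymm (ge_of_tendsto' (h.tendsto_measure_renewalTime_le hten hC0 hC T)
    fun n => measure_mono fun ω hω => ?_) zero_le
  simp only [not_exists, not_lt] at hω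
  exact hω n

/-- Almost surely, exactly one of the sojourns contains the time `T`. -/
lemma IsRenewalSequence.ae_exists_sojourn (h : IsRenewalSequence P A x₀ τ κ)
    (hten : Tenable A x₀) {C : ℝ} (hC0 : 0 < C) (hC : ∀ i, ∑ j, A i j ≤ C) {T : ℝ}
    (hT : 0 ≤ T) :
    ∀ᵐ ω ∂P, ∃ n, (renewalTime τ n ω ≤ T ∧ T < renewalTime τ (n + 1) ω) ∧
      ∀ m, m ≠ n → ¬ (renewalTime τ m ω ≤ T ∧ T < renewalTime τ (m + 1) ω) := by
  filter_upwards [h.ae_exists_lt_renewalTime hten hC0 hC T,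
    ae_all_iff.2 fun n => h.ae_waiting_pos hten n] with ω hex hpos
  have hmono : StrictMono fun n => renewalTime τ n ω :=
    strictMono_nat_of_lt_succ fun n => by rw [renewalTime_succ]; linarith [hpos n]
  classical
  -- The first renewal after T is not the zeroth, whose time is 0 ≤ T; its predecessor starts the
  -- sojourn.
  obtain ⟨n, hn⟩ : ∃ n, Nat.find hex = n + 1 := by
    refine Nat.exists_eq_succ_of_ne_zero fun h0 => ?_
    have := Nat.find_spec hex
    rw [h0] at this
    simp only [renewalTime, Finset.range_zero, Finset.sum_empty] at this
    linarith
  refine ⟨n, ⟨not_lt.1 (Nat.find_min hex (m := n) (by omega)), ?_⟩, ?_⟩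
  · rw [← hn]
    exact Nat.find_spec hex
  · rintro m hm ⟨h1, h2⟩
    have h3 : T < renewalTime τ (n + 1) ω := hn ▸ Nat.find_spec hex
    have h4 : renewalTime τ n ω ≤ T := not_lt.1 (Nat.find_min hex (m := n) (by omega))
    have h5 := hmono.lt_iff_lt.1 (h1.trans_lt h3)
    have h6 := hmono.lt_iff_lt.1 (h4.trans_lt h2)
    omega

end Explosion

/-! ### The candidate generating function and its backward equation. -/

section Reflection

/-- Candidate for `E[(1 + v) ^ (X t 0 / γ)]` when the walk starts at `z`. -/
noncomputable def genFun (γ v t : ℝ) (z : Fin 2 → ℝ) : ℝ :=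
  (1 - γ * t * v + v) ^ (z 0 / γ) / (1 - γ * t * v) ^ (z 1 / γ)

variable {γ v t : ℝ}

lemma one_sub_mul_pos {T : ℝ} (hγ : 0 < γ) (hT : γ * T * v < 1) (ht0 : 0 ≤ t) (htT : t ≤ T) :
    0 < 1 - γ * t * v := by
  rcases le_total v 0 with hv | hv
  · nlinarith [mul_nonneg hγ.le ht0]
  · nlinarith [mul_le_mul_of_nonneg_left htT (mul_nonneg hγ.le hv)]

/-- If v ≤ 0 then D ≥ 1, so N ≥ 1 + v > 0; otherwise N ≥ D. -/
lemma one_sub_mul_add_pos (hγ : 0 < γ) (ht0 : 0 ≤ t) (hv : -1 < v)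
    (hD : 0 < 1 - γ * t * v) : 0 < 1 - γ * t * v + v := by
  rcases le_total v 0 with h | h
  · nlinarith [mul_nonneg hγ.le ht0]
  · linarith

lemma genFun_nonneg (hD : 0 ≤ 1 - γ * t * v) (hN : 0 ≤ 1 - γ * t * v + v) (z : Fin 2 → ℝ) :
    0 ≤ genFun γ v t z := by
  unfold genFun
  positivity

lemma genFun_zero (γ v : ℝ) (z : Fin 2 → ℝ) : genFun γ v 0 z = (1 + v) ^ (z 0 / γ) := by
  simp [genFun]

lemma measurable_genFun (γ v : ℝ) : Measurable fun p : ℝ × (Fin 2 → ℝ) => genFun γ v p.1 p.2 := by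
  unfold genFun
  fun_prop

/-- A renewal shifts both exponents by one, so it multiplies the candidate by D/N or, for the other
colour, by N/D; the generator therefore acts by an explicit factor. -/
lemma genFun_add_row_zero (hγ : 0 < γ) (hD : 0 < 1 - γ * t * v) (hN : 0 < 1 - γ * t * v + v)
    (z : Fin 2 → ℝ) :
    genFun γ v t (z + !![-γ, -γ; γ, γ] 0) =
      genFun γ v t z * ((1 - γ * t * v) / (1 - γ * t * v + v)) := by
  have h (x : ℝ) : (x + -γ) / γ = x / γ - 1 := by field_simp; ring
  simp only [genFun, Pi.add_apply, Matrix.of_apply, Matrix.cons_val', Matrix.cons_val_zero,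
    Matrix.cons_val_one, h, Real.rpow_sub_one hD.ne', Real.rpow_sub_one hN.ne']
  have := Real.rpow_pos_of_pos hD (z 1 / γ)
  field_simp

lemma genFun_add_row_one (hγ : 0 < γ) (hD : 0 < 1 - γ * t * v) (hN : 0 < 1 - γ * t * v + v)
    (z : Fin 2 → ℝ) :
    genFun γ v t (z + !![-γ, -γ; γ, γ] 1) =
      genFun γ v t z * ((1 - γ * t * v + v) / (1 - γ * t * v)) := by
  have h (x : ℝ) : (x + γ) / γ = x / γ + 1 := by field_simp
  simp only [genFun, Pi.add_apply, Matrix.of_apply, Matrix.cons_val', Matrix.cons_val_zero,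
    Matrix.cons_val_one, h, Real.rpow_add_one hD.ne', Real.rpow_add_one hN.ne']
  have := Real.rpow_pos_of_pos hD (z 1 / γ)
  field_simp

/-- The backward Kolmogorov equation. -/
lemma hasDerivAt_genFun (hγ : 0 < γ) (hD : 0 < 1 - γ * t * v) (hN : 0 < 1 - γ * t * v + v)
    (z : Fin 2 → ℝ) :
    HasDerivAt (fun t => genFun γ v t z)
      (∑ i, z i * (genFun γ v t (z + !![-γ, -γ; γ, γ] i) - genFun γ v t z)) t := by
  have hD' : HasDerivAt (fun t => 1 - γ * t * v) (-(γ * v)) t := by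
    simpa using (((hasDerivAt_id t).const_mul γ).mul_const v).const_sub 1
  have hN' : HasDerivAt (fun t => 1 - γ * t * v + v) (-(γ * v)) t := hD'.add_const v
  have h0 := Real.rpow_pos_of_pos hD (z 1 / γ)
  refine ((hN'.rpow_const (p := z 0 / γ) (.inl hN.ne')).div
    (hD'.rpow_const (p := z 1 / γ) (.inl hD.ne')) h0.ne').congr_deriv ?_
  rw [Fin.sum_univ_two, genFun_add_row_zero hγ hD hN, genFun_add_row_one hγ hD hN, genFun,
    Real.rpow_sub_one hD.ne', Real.rpow_sub_one hN.ne']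
  clear hD' hN'
  generalize 1 - γ * t * v = D at *
  have hN' := hN.ne'
  field_simp
  ring

/-- The backward equation in integrated form: decompose according to the first renewal. -/
lemma genFun_eq_integral (hγ : 0 < γ) (hv : -1 < v) (ht : 0 ≤ t) (htv : γ * t * v < 1)
    (z : Fin 2 → ℝ) :
    genFun γ v t z = Real.exp (-(t * ∑ j, z j)) * genFun γ v 0 z +
      ∫ s in (0 : ℝ)..t, ∑ i, z i * Real.exp (-(s * ∑ j, z j)) *
        genFun γ v (t - s) (z + !![-γ, -γ; γ, γ] i) := by
  set R := ∑ j, z j with hR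
  have hpos : ∀ s ∈ Set.uIcc 0 t, 0 < 1 - γ * (t - s) * v ∧ 0 < 1 - γ * (t - s) * v + v := by
    intro s hs
    rw [Set.uIcc_of_le ht] at hs
    have hD := one_sub_mul_pos hγ htv (t := t - s) (by linarith [hs.2]) (by linarith [hs.1])
    exact ⟨hD, one_sub_mul_add_pos hγ (by linarith [hs.2]) hv hD⟩
  have hcont : ∀ w, ContinuousOn (fun s => genFun γ v (t - s) w) (Set.uIcc 0 t) := by
    intro w s hs
    obtain ⟨hD, hN⟩ := hpos s hs
    have h1 := (hasDerivAt_genFun hγ hD hN w).continuousAt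
    exact (ContinuousAt.comp (f := fun s => t - s) (x := s) h1 (by fun_prop)).continuousWithinAt
  -- The survival factor exp(−sR) is an integrating factor: its derivative cancels the holding term
  -- of the backward equation and only the jump terms remain.
  have hderiv : ∀ s ∈ Set.uIcc 0 t,
      HasDerivAt (fun s => Real.exp (-(s * R)) * genFun γ v (t - s) z)
        (-∑ i, z i * Real.exp (-(s * R)) * genFun γ v (t - s) (z + !![-γ, -γ; γ, γ] i)) s := by
    intro s hs
    obtain ⟨hD, hN⟩ := hpos s hs
    have h1 : HasDerivAt (fun s => Real.exp (-(s * R))) (Real.exp (-(s * R)) * -R) s := by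
      simpa using ((hasDerivAt_id s).mul_const R).neg.exp
    have h2 := HasDerivAt.comp_const_sub t s (hasDerivAt_genFun hγ hD hN z)
    refine (h1.mul h2).congr_deriv ?_
    simp only [Fin.sum_univ_two] at hR ⊢
    rw [hR]
    ring
  have hint : IntervalIntegrable (fun s => -∑ i, z i * Real.exp (-(s * R)) *
      genFun γ v (t - s) (z + !![-γ, -γ; γ, γ] i)) volume 0 t := by
    refine ContinuousOn.intervalIntegrable ?_
    refine (continuousOn_finsetSum _ fun i _ => ?_).neg
    exact ContinuousOn.mul (by fun_prop) (hcont _)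
  have key := intervalIntegral.integral_eq_sub_of_hasDerivAt hderiv hint
  rw [intervalIntegral.integral_neg] at key
  simp only [sub_self, sub_zero, zero_mul, neg_zero, Real.exp_zero, one_mul] at key
  linarith

/-- All terms are nonnegative, so the extended-valued form can be averaged over the walk before any
integrability is known. -/
lemma ofReal_genFun_eq_lintegral (hγ : 0 < γ) (hv : -1 < v) (ht : 0 ≤ t) (htv : γ * t * v < 1)
    {z : Fin 2 → ℝ} (hz0 : ∀ i, 0 ≤ z i) :
    ENNReal.ofReal (genFun γ v t z) =
      ENNReal.ofReal (Real.exp (-(t * ∑ j, z j))) * ENNReal.ofReal (genFun γ v 0 z) +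
      ∑ i, ∫⁻ s in Set.Ioc 0 t, jumpDensity z i s *
        ENNReal.ofReal (genFun γ v (t - s) (z + !![-γ, -γ; γ, γ] i)) := by
  have hpos : ∀ s ∈ Set.Icc 0 t, 0 < 1 - γ * (t - s) * v ∧ 0 < 1 - γ * (t - s) * v + v := by
    intro s hs
    have hD := one_sub_mul_pos hγ htv (t := t - s) (by linarith [hs.2]) (by linarith [hs.1])
    exact ⟨hD, one_sub_mul_add_pos hγ (by linarith [hs.2]) hv hD⟩
  have hcont : ∀ i w, ContinuousOn
      (fun s => z i * Real.exp (-(s * ∑ j, z j)) * genFun γ v (t - s) w) (Set.Icc 0 t) := by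
    intro i w
    refine ContinuousOn.mul (by fun_prop) fun s hs => ?_
    obtain ⟨hD, hN⟩ := hpos s hs
    have h1 := (hasDerivAt_genFun hγ hD hN w).continuousAt
    exact (ContinuousAt.comp (f := fun s => t - s) (x := s) h1 (by fun_prop)).continuousWithinAt
  have hnn : ∀ s ∈ Set.Icc 0 t, ∀ i, 0 ≤ z i * Real.exp (-(s * ∑ j, z j)) *
      genFun γ v (t - s) (z + !![-γ, -γ; γ, γ] i) := fun s hs i =>
    mul_nonneg (mul_nonneg (hz0 i) (Real.exp_pos _).le)
      (genFun_nonneg (hpos s hs).1.le (hpos s hs).2.le _)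
  have hg0 : 0 ≤ genFun γ v 0 z := by
    rw [genFun_zero]
    exact Real.rpow_nonneg (by linarith) _
  have hmeas : ∀ i, Measurable fun s => jumpDensity z i s *
      ENNReal.ofReal (genFun γ v (t - s) (z + !![-γ, -γ; γ, γ] i)) := by
    intro i
    have hd : Measurable (jumpDensity z i) := by unfold jumpDensity; fun_prop
    refine hd.mul ?_
    exact ((measurable_genFun γ v).comp
      ((measurable_const.sub measurable_id).prodMk measurable_const)).ennreal_ofReal
  rw [genFun_eq_integral hγ hv ht htv z, intervalIntegral.integral_of_le ht, ENNReal.ofReal_add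
    (by positivity) (setIntegral_nonneg measurableSet_Ioc fun s hs => Finset.sum_nonneg fun i _ =>
      hnn s ⟨hs.1.le, hs.2⟩ i), ENNReal.ofReal_mul (Real.exp_pos _).le,
    ofReal_integral_eq_lintegral_ofReal, ← lintegral_finsetSum _ fun i _ => hmeas i]
  · congr 1
    refine setLIntegral_congr_fun measurableSet_Ioc fun s hs => ?_
    have hs' : s ∈ Set.Icc 0 t := ⟨hs.1.le, hs.2⟩
    rw [ENNReal.ofReal_sum_of_nonneg fun i _ => hnn s hs' i]
    refine Finset.sum_congr rfl fun i _ => ?_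
    rw [ENNReal.ofReal_mul (mul_nonneg (hz0 i) (Real.exp_pos _).le), jumpDensity]
  · refine ContinuousOn.integrableOn_Icc ?_ |>.mono_set Set.Ioc_subset_Icc_self
    exact continuousOn_finsetSum _ fun i _ => hcont i _
  · filter_upwards [ae_restrict_mem measurableSet_Ioc] with s hs
    exact Finset.sum_nonneg fun i _ => hnn s ⟨hs.1.le, hs.2⟩ i

end Reflection

/-! ### Telescoping over the renewals. -/

section FirstRenewal

variable {Ω : Type*} [MeasurableSpace Ω] {P : Measure Ω} [IsProbabilityMeasure P]
  {γ v T : ℝ} {x₀ : Fin 2 → ℝ} {τ : ℕ → Ω → ℝ} {κ : ℕ → Ω → Fin 2}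

/-- What the candidate generating function predicts after the `n`-th renewal, if that renewal
occurs by time `T`. -/
noncomputable def pastTerm (γ v T : ℝ) (r : ℝ) (z : Fin 2 → ℝ) : ENNReal :=
  if r ≤ T then ENNReal.ofReal (genFun γ v (T - r) z) else 0

/-- The contribution of a sojourn at `z` between the times `r` and `r'`, if it contains `T`. -/
noncomputable def sojournTerm (γ v T : ℝ) (r r' : ℝ) (z : Fin 2 → ℝ) : ENNReal :=
  if r ≤ T ∧ T < r' then ENNReal.ofReal (genFun γ v 0 z) else 0

lemma measurable_pastTerm (γ v T : ℝ) :
    Measurable fun p : ℝ × (Fin 2 → ℝ) => pastTerm γ v T p.1 p.2 := by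
  refine Measurable.ite (measurableSet_le measurable_fst measurable_const) ?_ measurable_const
  exact ((measurable_genFun γ v).comp
    ((measurable_const.sub measurable_fst).prodMk measurable_snd)).ennreal_ofReal

lemma measurable_sojournTerm (γ v T : ℝ) :
    Measurable fun p : (ℝ × ℝ) × (Fin 2 → ℝ) => sojournTerm γ v T p.1.1 p.1.2 p.2 := by
  refine Measurable.ite ?_ ?_ measurable_const
  · exact (measurableSet_le measurable_fst.fst measurable_const).inter
      (measurableSet_lt measurable_const measurable_fst.snd)
  · exact ((measurable_genFun γ v).comp
      (measurable_const.prodMk measurable_snd)).ennreal_ofReal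

/-- This is the integrated backward equation with remaining time T − r: a waiting time beyond T − r
leaves T in the current sojourn, a shorter one restarts the candidate at the new position. For r > T
both sides vanish. -/
lemma sum_lintegral_jumpDensity_mul_terms (hγ : 0 < γ) (hv : -1 < v) (hTv : γ * T * v < 1)
    {z : Fin 2 → ℝ} (hz0 : ∀ i, 0 ≤ z i) (hz : 0 < ∑ j, z j) {r : ℝ} (hr : 0 ≤ r) :
    ∑ i, ∫⁻ s in Set.Ioi 0, jumpDensity z i s * (sojournTerm γ v T r (r + s) z +
      pastTerm γ v T (r + s) (z + !![-γ, -γ; γ, γ] i)) = pastTerm γ v T r z := by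
  rcases lt_or_ge T r with hTr | hrT
  · rw [pastTerm, if_neg hTr.not_ge]
    refine Finset.sum_eq_zero fun i _ => ?_
    rw [← lintegral_zero (μ := volume.restrict (Set.Ioi (0 : ℝ)))]
    refine setLIntegral_congr_fun measurableSet_Ioi fun s (hs : 0 < s) => ?_
    rw [sojournTerm, pastTerm, if_neg (fun h => hTr.not_ge h.1), if_neg (by linarith), add_zero,
      mul_zero]
  · have ht : 0 ≤ T - r := sub_nonneg.2 hrT
    have htv : γ * (T - r) * v < 1 := by
      have := one_sub_mul_pos hγ hTv ht (by linarith)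
      linarith
    have h1 : ∀ i, ∫⁻ s in Set.Ioi 0, jumpDensity z i s * (sojournTerm γ v T r (r + s) z +
        pastTerm γ v T (r + s) (z + !![-γ, -γ; γ, γ] i)) =
        (∫⁻ s in Set.Ioc 0 (T - r), jumpDensity z i s *
          ENNReal.ofReal (genFun γ v (T - r - s) (z + !![-γ, -γ; γ, γ] i))) +
        ENNReal.ofReal (Real.exp (-((T - r) * ∑ j, z j)) * (z i / ∑ j, z j)) *
          ENNReal.ofReal (genFun γ v 0 z) := by
      intro i
      rw [← Set.Ioc_union_Ioi_eq_Ioi ht, lintegral_union measurableSet_Ioi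
        Set.Ioc_disjoint_Ioi_same, ← lintegral_Ioi_jumpDensity i (hz0 i) hz, ← lintegral_mul_const]
      · congr 1
        · refine setLIntegral_congr_fun measurableSet_Ioc fun s hs => ?_
          have h2 : ¬ (r ≤ T ∧ T < r + s) := fun h => by linarith [h.2, hs.2]
          have h3 : r + s ≤ T := by linarith [hs.2]
          rw [sojournTerm, pastTerm, if_neg h2, if_pos h3, zero_add, sub_sub]
        · refine setLIntegral_congr_fun measurableSet_Ioi fun s (hs : T - r < s) => ?_
          have h2 : r ≤ T ∧ T < r + s := ⟨hrT, by linarith⟩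
          have h3 : ¬ (r + s ≤ T) := by linarith
          rw [sojournTerm, pastTerm, if_pos h2, if_neg h3, add_zero]
      · unfold jumpDensity
        fun_prop
    simp_rw [h1]
    rw [pastTerm, if_pos hrT, ofReal_genFun_eq_lintegral hγ hv ht htv hz0,
      Finset.sum_add_distrib, add_comm, ← Finset.sum_mul, ← ENNReal.ofReal_sum_of_nonneg,
      ← Finset.mul_sum, ← Finset.sum_div, div_self hz.ne', mul_one]
    exact fun i _ => mul_nonneg (Real.exp_pos _).le (div_nonneg (hz0 i) hz.le)

lemma IsRenewalSequence.ae_renewalTime_nonneg {c : ℕ} {A : Matrix (Fin c) (Fin c) ℝ}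
    {x₀ : Fin c → ℝ} {κ : ℕ → Ω → Fin c} (h : IsRenewalSequence P A x₀ τ κ)
    (hten : Tenable A x₀) (n : ℕ) : ∀ᵐ ω ∂P, 0 ≤ renewalTime τ n ω := by
  filter_upwards [ae_all_iff.2 fun n => h.ae_waiting_pos hten n] with ω hω
  exact Finset.sum_nonneg fun k _ => (hω k).le

lemma IsRenewalSequence.lintegral_pastTerm_eq
    (h : IsRenewalSequence P !![-γ, -γ; γ, γ] x₀ τ κ) (hten : Tenable !![-γ, -γ; γ, γ] x₀)
    (hγ : 0 < γ) (hv : -1 < v) (hTv : γ * T * v < 1) (n : ℕ) :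
    ∫⁻ ω, pastTerm γ v T (renewalTime τ n ω) (position !![-γ, -γ; γ, γ] x₀ κ n ω) ∂P =
      ∫⁻ ω, sojournTerm γ v T (renewalTime τ n ω) (renewalTime τ (n + 1) ω)
        (position !![-γ, -γ; γ, γ] x₀ κ n ω) ∂P +
      ∫⁻ ω, pastTerm γ v T (renewalTime τ (n + 1) ω)
        (position !![-γ, -γ; γ, γ] x₀ κ (n + 1) ω) ∂P := by
  have hs : Measurable fun ω => sojournTerm γ v T (renewalTime τ n ω) (renewalTime τ (n + 1) ω)
      (position !![-γ, -γ; γ, γ] x₀ κ n ω) :=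
    (measurable_sojournTerm γ v T).comp (((h.measurable_renewalTime n).prodMk
      (h.measurable_renewalTime (n + 1))).prodMk (h.measurable_position n))
  rw [← lintegral_add_left hs]
  have h1 := h.lintegral_next hten n (fun p s i => sojournTerm γ v T p.1 (p.1 + s) p.2 +
    pastTerm γ v T (p.1 + s) (p.2 + !![-γ, -γ; γ, γ] i)) (fun i => by
      refine Measurable.add ?_ ?_
      · exact (measurable_sojournTerm γ v T).comp ((measurable_fst.fst.prodMk
          (measurable_fst.fst.add measurable_snd)).prodMk measurable_fst.snd)
      · exact (measurable_pastTerm γ v T).comp ((measurable_fst.fst.add measurable_snd).prodMk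
          (measurable_fst.snd.add_const _)))
  simp only at h1
  simp_rw [renewalTime_succ, position_succ]
  rw [h1]
  refine lintegral_congr_ae ?_
  filter_upwards [h.ae_nonneg_and_sum_pos hten n, h.ae_renewalTime_nonneg hten n] with ω hz hr
  exact (sum_lintegral_jumpDensity_mul_terms hγ hv hTv hz.1 hz.2 hr).symm

lemma IsRenewalSequence.ofReal_genFun_eq_sum_add
    (h : IsRenewalSequence P !![-γ, -γ; γ, γ] x₀ τ κ) (hten : Tenable !![-γ, -γ; γ, γ] x₀)
    (hγ : 0 < γ) (hv : -1 < v) (hT : 0 ≤ T) (hTv : γ * T * v < 1) (n : ℕ) :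
    ENNReal.ofReal (genFun γ v T x₀) =
      ∑ k ∈ Finset.range n, ∫⁻ ω, sojournTerm γ v T (renewalTime τ k ω)
        (renewalTime τ (k + 1) ω) (position !![-γ, -γ; γ, γ] x₀ κ k ω) ∂P +
      ∫⁻ ω, pastTerm γ v T (renewalTime τ n ω) (position !![-γ, -γ; γ, γ] x₀ κ n ω) ∂P := by
  induction n with
  | zero => simp [renewalTime, position, pastTerm, hT]
  | succ n ih =>
    rw [ih, h.lintegral_pastTerm_eq hten hγ hv hTv n, Finset.sum_range_succ, add_assoc]

-- Each row of the navigation matrix adds the same amount to both coordinates.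
omit [MeasurableSpace Ω] in
lemma position_one_sub_zero (γ : ℝ) (x₀ : Fin 2 → ℝ) (κ : ℕ → Ω → Fin 2) (n : ℕ) (ω : Ω) :
    position !![-γ, -γ; γ, γ] x₀ κ n ω 1 =
      position !![-γ, -γ; γ, γ] x₀ κ n ω 0 + (x₀ 1 - x₀ 0) := by
  induction n with
  | zero => simp [position]
  | succ n ih =>
    rw [position_succ]
    rcases Fin.exists_fin_two.1 ⟨κ n ω, rfl⟩ with hk | hk
    all_goals
      rw [hk]
      simp [ih]
      try ring

/-- Here N ≤ D and D ≥ 1. The bound, uniform in the state, dominates the telescoping remainder by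
the probability of n renewals before T. -/
lemma genFun_le_one {t : ℝ} (hγ : 0 < γ) (hv : -1 < v) (hv0 : v ≤ 0) (ht : 0 ≤ t)
    {z : Fin 2 → ℝ} (hz0 : 0 ≤ z 0) (hz : z 0 ≤ z 1) : genFun γ v t z ≤ 1 := by
  have hD : 1 ≤ 1 - γ * t * v := by nlinarith [mul_nonneg hγ.le ht]
  have hN : 0 < 1 - γ * t * v + v := by linarith
  refine div_le_one_of_le₀ ?_ (by positivity)
  calc (1 - γ * t * v + v) ^ (z 0 / γ) ≤ (1 - γ * t * v) ^ (z 0 / γ) :=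
        Real.rpow_le_rpow hN.le (by linarith) (by positivity)
    _ ≤ (1 - γ * t * v) ^ (z 1 / γ) := Real.rpow_le_rpow_of_exponent_le hD (by gcongr)

lemma sum_row_le (hγ : 0 < γ) (i : Fin 2) : ∑ j, !![-γ, -γ; γ, γ] i j ≤ 2 * γ := by
  fin_cases i <;> simp [Fin.sum_univ_two] <;> linarith

lemma IsRenewalSequence.tendsto_lintegral_pastTerm
    (h : IsRenewalSequence P !![-γ, -γ; γ, γ] x₀ τ κ) (hten : Tenable !![-γ, -γ; γ, γ] x₀)
    (hγ : 0 < γ) (hx : x₀ 0 ≤ x₀ 1) (hv : -1 < v) (hv0 : v ≤ 0) (T : ℝ) :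
    Tendsto (fun n => ∫⁻ ω, pastTerm γ v T (renewalTime τ n ω)
      (position !![-γ, -γ; γ, γ] x₀ κ n ω) ∂P) atTop (𝓝 0) := by
  refine tendsto_of_tendsto_of_tendsto_of_le_of_le tendsto_const_nhds
    (h.tendsto_measure_renewalTime_le hten (by positivity) (sum_row_le hγ) T)
    (fun _ => zero_le) fun n => ?_
  have hm : MeasurableSet {ω | renewalTime τ n ω ≤ T} := h.measurable_renewalTime n measurableSet_Iic
  simp only
  rw [← lintegral_indicator_one hm]
  refine lintegral_mono_ae ?_
  filter_upwards [h.ae_nonneg_and_sum_pos hten n] with ω hω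
  rw [pastTerm]
  split_ifs with hT
  · rw [Set.indicator_of_mem (by exact hT), Pi.one_apply, ENNReal.ofReal_le_one]
    refine genFun_le_one hγ hv hv0 (sub_nonneg.2 hT) (hω.1 0) ?_
    rw [position_one_sub_zero γ x₀ κ n ω]
    linarith
  · exact zero_le

variable {X : ℝ≥0 → Ω → Fin 2 → ℝ}

/-- Countably many sojourn events cover almost all of the space, and on each of them the walk agrees
almost surely with a measurable position. -/
lemma IsContinuumPolyaWalk.aemeasurable {c : ℕ} {A : Matrix (Fin c) (Fin c) ℝ} {x₀ : Fin c → ℝ}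
    {X : ℝ≥0 → Ω → Fin c → ℝ} (hX : IsContinuumPolyaWalk P A x₀ X) (hten : Tenable A x₀)
    {C : ℝ} (hC0 : 0 < C) (hC : ∀ i, ∑ j, A i j ≤ C) (t : ℝ≥0) : AEMeasurable (X t) P := by
  obtain ⟨τ, κ, h, hXω⟩ := hX
  have hS : ∀ n, MeasurableSet {ω | renewalTime τ n ω ≤ t ∧ t < renewalTime τ (n + 1) ω} :=
    fun n => (measurableSet_le (h.measurable_renewalTime n) measurable_const).inter
      (measurableSet_lt measurable_const (h.measurable_renewalTime (n + 1)))
  have hU : P.restrict (⋃ n, {ω | renewalTime τ n ω ≤ t ∧ t < renewalTime τ (n + 1) ω}) = P := by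
    refine Measure.restrict_eq_self_of_ae_mem ?_
    filter_upwards [h.ae_exists_sojourn hten hC0 hC t.coe_nonneg] with ω ⟨n, hn, _⟩
    exact Set.mem_iUnion.2 ⟨n, hn⟩
  rw [← hU, aemeasurable_iUnion_iff]
  refine fun n => (h.measurable_position n).aemeasurable.congr ?_
  filter_upwards [ae_restrict_mem (hS n), ae_restrict_of_ae hXω] with ω hω hX
  exact (hX n t hω.1 hω.2).symm

lemma lintegral_rpow_eq_tsum (h : IsRenewalSequence P !![-γ, -γ; γ, γ] x₀ τ κ)
    (hten : Tenable !![-γ, -γ; γ, γ] x₀) (hγ : 0 < γ) (v : ℝ)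
    (hX : ∀ᵐ ω ∂P, ∀ (n : ℕ) (t : ℝ≥0), renewalTime τ n ω ≤ t → t < renewalTime τ (n + 1) ω →
      X t ω = position !![-γ, -γ; γ, γ] x₀ κ n ω) (t : ℝ≥0) :
    ∫⁻ ω, ENNReal.ofReal ((1 + v) ^ (X t ω 0 / γ)) ∂P =
      ∑' n, ∫⁻ ω, sojournTerm γ v t (renewalTime τ n ω) (renewalTime τ (n + 1) ω)
        (position !![-γ, -γ; γ, γ] x₀ κ n ω) ∂P := by
  rw [← lintegral_tsum]
  · refine lintegral_congr_ae ?_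
    filter_upwards [hX, h.ae_exists_sojourn hten (by positivity) (sum_row_le hγ) t.coe_nonneg]
      with ω hω ⟨n, hn, hn'⟩
    have h0 : ∀ m, m ≠ n → sojournTerm γ v t (renewalTime τ m ω) (renewalTime τ (m + 1) ω)
        (position !![-γ, -γ; γ, γ] x₀ κ m ω) = 0 := fun m hm => if_neg (hn' m hm)
    rw [tsum_eq_single n h0, sojournTerm, if_pos hn, genFun_zero, hω n t hn.1 hn.2]
  · exact fun n => ((measurable_sojournTerm γ v t).comp (((h.measurable_renewalTime n).prodMk
      (h.measurable_renewalTime (n + 1))).prodMk (h.measurable_position n))).aemeasurable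

/-- Every partial sum is the candidate minus a nonnegative remainder. This also covers v > 0, where
it supplies the integrability needed for analytic continuation. -/
lemma IsContinuumPolyaWalk.lintegral_rpow_le
    (hX : IsContinuumPolyaWalk P !![-γ, -γ; γ, γ] x₀ X) (hten : Tenable !![-γ, -γ; γ, γ] x₀)
    (hγ : 0 < γ) (hv : -1 < v) (t : ℝ≥0) (htv : γ * t * v < 1) :
    ∫⁻ ω, ENNReal.ofReal ((1 + v) ^ (X t ω 0 / γ)) ∂P ≤ ENNReal.ofReal (genFun γ v t x₀) := by
  obtain ⟨τ, κ, h, hXω⟩ := hX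
  rw [lintegral_rpow_eq_tsum h hten hγ v hXω]
  refine ENNReal.tsum_le_of_sum_range_le fun n => ?_
  rw [h.ofReal_genFun_eq_sum_add hten hγ hv t.coe_nonneg htv n]
  exact le_self_add

lemma IsContinuumPolyaWalk.lintegral_rpow_eq
    (hX : IsContinuumPolyaWalk P !![-γ, -γ; γ, γ] x₀ X) (hten : Tenable !![-γ, -γ; γ, γ] x₀)
    (hγ : 0 < γ) (hx : x₀ 0 ≤ x₀ 1) (hv : -1 < v) (hv0 : v ≤ 0) (t : ℝ≥0) :
    ∫⁻ ω, ENNReal.ofReal ((1 + v) ^ (X t ω 0 / γ)) ∂P = ENNReal.ofReal (genFun γ v t x₀) := by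
  obtain ⟨τ, κ, h, hXω⟩ := hX
  have htv : γ * t * v < 1 := by
    have : 0 ≤ γ * t := by positivity
    nlinarith
  rw [lintegral_rpow_eq_tsum h hten hγ v hXω]
  refine tendsto_nhds_unique ENNReal.summable.hasSum.tendsto_sum_nat ?_
  have h1 := ENNReal.Tendsto.sub (tendsto_const_nhds (x := ENNReal.ofReal (genFun γ v t x₀)))
    (h.tendsto_lintegral_pastTerm hten hγ hx hv hv0 t) (.inl ENNReal.ofReal_ne_top)
  rw [tsub_zero] at h1
  refine h1.congr fun n => ?_
  have h2 := h.ofReal_genFun_eq_sum_add hten hγ hv t.coe_nonneg htv n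
  refine ENNReal.sub_eq_of_eq_add (fun htop => ?_) h2
  exact ENNReal.ofReal_ne_top (h2.trans (by rw [htop, add_top]))

lemma IsContinuumPolyaWalk.ae_one_eq (hX : IsContinuumPolyaWalk P !![-γ, -γ; γ, γ] x₀ X)
    (hten : Tenable !![-γ, -γ; γ, γ] x₀) (hγ : 0 < γ) (t : ℝ≥0) :
    ∀ᵐ ω ∂P, X t ω 1 = X t ω 0 + (x₀ 1 - x₀ 0) := by
  obtain ⟨τ, κ, h, hXω⟩ := hX
  filter_upwards [hXω, h.ae_exists_sojourn hten (by positivity) (sum_row_le hγ) t.coe_nonneg]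
    with ω hω ⟨n, hn, _⟩
  rw [hω n t hn.1 hn.2]
  exact position_one_sub_zero γ x₀ κ n ω

end FirstRenewal

/-! ### Complex moment generating functions and analytic continuation. -/

section Transforms

variable {Ω : Type*} [MeasurableSpace Ω] {P : Measure Ω}

/-- A holomorphic function that agrees with the moment generating function at negative reals
agrees with the complex one on the whole strip. -/
lemma complexMGF_eqOn_of_mgf_eq {Z : Ω → ℝ} {S : Set ℝ} (hS : IsOpen S) (hSc : S.OrdConnected)
    (hneg : Set.Iio 0 ⊆ S) (hint : S ⊆ integrableExpSet Z P) {F : ℂ → ℂ}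
    (hF : DifferentiableOn ℂ F {z | z.re ∈ S})
    (h : ∀ u : ℝ, u < 0 → (mgf Z P u : ℂ) = F u) :
    Set.EqOn (complexMGF Z P) F {z | z.re ∈ S} := by
  have hopen : IsOpen {z : ℂ | z.re ∈ S} := hS.preimage Complex.continuous_re
  have hsub : {z : ℂ | z.re ∈ S} ⊆ {z | z.re ∈ interior (integrableExpSet Z P)} :=
    fun z hz => interior_maximal hint hS hz
  have hconv : Convex ℝ {z : ℂ | z.re ∈ S} := hSc.convex.linear_preimage Complex.reLm
  -- Identity theorem at −1, an accumulation point of negative reals where the two functions agree.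
  refine AnalyticOnNhd.eqOn_of_preconnected_of_frequently_eq
    (analyticOnNhd_complexMGF.mono hsub) (hF.analyticOnNhd hopen) hconv.isPreconnected
    (z₀ := ((-1 : ℝ) : ℂ)) (by simpa using hneg (by simp : (-1 : ℝ) ∈ Set.Iio 0)) ?_
  have htend : Tendsto (fun u : ℝ => (u : ℂ)) (𝓝[≠] (-1)) (𝓝[≠] ((-1 : ℝ) : ℂ)) := by
    refine tendsto_nhdsWithin_of_tendsto_nhds_of_eventually_within _
      (Complex.continuous_ofReal.continuousAt.tendsto.mono_left nhdsWithin_le_nhds) ?_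
    filter_upwards [self_mem_nhdsWithin] with u hu
    exact fun hc => hu (Complex.ofReal_injective hc)
  refine htend.frequently (Eventually.frequently ?_)
  filter_upwards [nhdsWithin_le_nhds (Iio_mem_nhds (by norm_num : (-1 : ℝ) < 0))] with u hu
  rw [complexMGF_ofReal]
  exact h u hu

section Gamma

variable {a r : ℝ}

/-- Exponential tilting turns the gamma density of rate r into a multiple of the one of rate r − u,
whose total mass is one. -/
lemma lintegral_exp_mul_gammaMeasure (ha : 0 < a) (hr : 0 < r) {u : ℝ} (hu : u < r) :
    ∫⁻ x, ENNReal.ofReal (Real.exp (u * x)) ∂gammaMeasure a r =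
      ENNReal.ofReal ((r / (r - u)) ^ a) := by
  have hru : 0 < r - u := sub_pos.2 hu
  have hm : ∀ r, Measurable (gammaPDF a r) := fun r => (measurable_gammaPDFReal a r).ennreal_ofReal
  rw [gammaMeasure, lintegral_withDensity_eq_lintegral_mul _ (hm r) (by fun_prop)]
  have h1 : ∀ x, (gammaPDF a r * fun x => ENNReal.ofReal (Real.exp (u * x))) x =
      ENNReal.ofReal ((r / (r - u)) ^ a) * gammaPDF a (r - u) x := by
    intro x
    have hx : gammaPDFReal a r x * Real.exp (u * x) =
        (r / (r - u)) ^ a * gammaPDFReal a (r - u) x := by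
      unfold gammaPDFReal
      split_ifs with h0
      · have h2 : Real.exp (-(r * x)) * Real.exp (u * x) = Real.exp (-((r - u) * x)) := by
          rw [← Real.exp_add]
          ring_nf
        have h3 := Real.rpow_pos_of_pos hru a
        rw [← h2, Real.div_rpow hr.le hru.le]
        field_simp
      · simp
    rw [Pi.mul_apply, gammaPDF, gammaPDF, ← ENNReal.ofReal_mul (gammaPDFReal_nonneg ha hr x), hx,
      ENNReal.ofReal_mul (by positivity)]
  simp_rw [h1]
  rw [lintegral_const_mul _ (hm (r - u)),
    lintegral_gammaPDF_eq_one ha hru, mul_one]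

lemma integrable_exp_mul_of_lintegral_ne_top {Z : Ω → ℝ} (hZ : AEMeasurable Z P) {u : ℝ}
    (h : ∫⁻ ω, ENNReal.ofReal (Real.exp (u * Z ω)) ∂P ≠ ⊤) :
    Integrable (fun ω => Real.exp (u * Z ω)) P := by
  refine ⟨(Real.measurable_exp.comp_aemeasurable (hZ.const_mul u)).aestronglyMeasurable, ?_⟩
  rw [hasFiniteIntegral_iff_ofReal (ae_of_all _ fun _ => (Real.exp_pos _).le)]
  exact h.lt_top

lemma mgf_eq_toReal_lintegral {Z : Ω → ℝ} (hZ : AEMeasurable Z P) (u : ℝ) :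
    mgf Z P u = (∫⁻ ω, ENNReal.ofReal (Real.exp (u * Z ω)) ∂P).toReal :=
  integral_eq_lintegral_of_nonneg_ae (ae_of_all _ fun _ => (Real.exp_pos _).le)
    (Real.measurable_exp.comp_aemeasurable (hZ.const_mul u)).aestronglyMeasurable

/-- The complex moment generating function of a gamma law. -/
lemma complexMGF_gammaMeasure (ha : 0 < a) (hr : 0 < r) {z : ℂ} (hz : z.re < r) :
    complexMGF (id : ℝ → ℝ) (gammaMeasure a r) z = 1 / (1 - z / r) ^ (a : ℂ) := by
  have hre : ∀ z : ℂ, z.re < r → 0 < (1 - z / r).re := by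
    intro z hz
    rw [Complex.sub_re, Complex.div_ofReal_re, Complex.one_re, sub_pos, div_lt_one hr]
    exact hz
  refine complexMGF_eqOn_of_mgf_eq (P := gammaMeasure a r) (Z := id) (S := Set.Iio r)
    (F := fun z => 1 / (1 - z / r) ^ (a : ℂ)) isOpen_Iio Set.ordConnected_Iio
    (Set.Iio_subset_Iio hr.le) (fun u (hu : u < r) => ?_) ?_ (fun u hu => ?_) hz
  · refine integrable_exp_mul_of_lintegral_ne_top aemeasurable_id ?_
    simp only [id]
    rw [lintegral_exp_mul_gammaMeasure ha hr hu]
    exact ENNReal.ofReal_ne_top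
  · intro z hz
    have h1 : 1 - z / r ∈ Complex.slitPlane := .inl (hre z hz)
    have h2 : DifferentiableAt ℂ (fun z : ℂ => (1 - z / r) ^ (a : ℂ)) z :=
      DifferentiableAt.cpow_const (by fun_prop) h1
    refine ((differentiableAt_const 1).div h2 ?_).differentiableWithinAt
    rw [Ne, Complex.cpow_eq_zero_iff]
    exact fun h => Complex.slitPlane_ne_zero h1 h.1
  · have hur : u < r := hu.trans hr
    have h1 : 0 < 1 - u / r := by
      rw [sub_pos, div_lt_one hr]
      exact hur
    rw [mgf_eq_toReal_lintegral aemeasurable_id]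
    simp only [id]
    rw [lintegral_exp_mul_gammaMeasure ha hr hur, ENNReal.toReal_ofReal (Real.rpow_nonneg
      (div_nonneg hr.le (sub_pos.2 hur).le) _)]
    have h2 : r / (r - u) = (1 - u / r)⁻¹ := by
      have := (sub_pos.2 hur).ne'
      field_simp
    rw [h2, Real.inv_rpow h1.le, Complex.ofReal_inv, Complex.ofReal_cpow h1.le]
    push_cast
    rw [one_div]

end Gamma

section Walk

variable [IsProbabilityMeasure P] {γ : ℝ} {x₀ : Fin 2 → ℝ} {X : ℝ≥0 → Ω → Fin 2 → ℝ}

/-- Otherwise repeated renewals of the first type never land on zero, so they stay possible and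
eventually make the first coordinate negative. -/
lemma Tenable.exists_natCast (hγ : 0 < γ) (hten : Tenable !![-γ, -γ; γ, γ] x₀) :
    ∃ m : ℕ, x₀ 0 / γ = m := by
  by_contra! hne
  have h1 : ∀ k : ℕ, Reachable !![-γ, -γ; γ, γ] x₀ (x₀ + (k : ℝ) • !![-γ, -γ; γ, γ] 0) := by
    intro k
    induction k with
    | zero => simpa using Reachable.start
    | succ k ih =>
      have h2 : 0 < (x₀ + (k : ℝ) • !![-γ, -γ; γ, γ] 0) 0 := by
        refine ((hten _ ih).1 0).lt_of_ne fun h0 => hne k ?_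
        simp at h0
        rw [div_eq_iff hγ.ne']
        linarith
      have h3 := ih.step 0 h2
      rw [Nat.cast_succ, add_smul, one_smul, ← add_assoc]
      exact h3
  obtain ⟨k, hk⟩ := exists_nat_gt (x₀ 0 / γ)
  have h2 := (hten _ (h1 k)).1 0
  rw [div_lt_iff₀ hγ] at hk
  simp at h2
  linarith

lemma IsContinuumPolyaWalk.aemeasurable_coord
    (hX : IsContinuumPolyaWalk P !![-γ, -γ; γ, γ] x₀ X) (hten : Tenable !![-γ, -γ; γ, γ] x₀)
    (hγ : 0 < γ) (t : ℝ≥0) (i : Fin 2) : AEMeasurable (fun ω => X t ω i) P :=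
  (measurable_pi_apply i).comp_aemeasurable
    (hX.aemeasurable hten (by positivity) (sum_row_le hγ) t)

lemma exp_mul_eq_rpow (hγ : 0 < γ) (u x : ℝ) :
    Real.exp (u * x) = (1 + (Real.exp (γ * u) - 1)) ^ (x / γ) := by
  rw [add_sub_cancel, ← Real.exp_mul]
  congr 1
  field_simp

lemma IsContinuumPolyaWalk.integrable_exp
    (hX : IsContinuumPolyaWalk P !![-γ, -γ; γ, γ] x₀ X) (hten : Tenable !![-γ, -γ; γ, γ] x₀)
    (hγ : 0 < γ) (t : ℝ≥0) {u : ℝ} (hu : γ * t * (Real.exp (γ * u) - 1) < 1) :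
    Integrable (fun ω => Real.exp (u * X t ω 0)) P := by
  refine integrable_exp_mul_of_lintegral_ne_top (hX.aemeasurable_coord hten hγ t 0) ?_
  simp_rw [exp_mul_eq_rpow hγ u]
  refine ne_top_of_le_ne_top ENNReal.ofReal_ne_top
    (hX.lintegral_rpow_le hten hγ ?_ t hu)
  linarith [Real.exp_pos (γ * u)]

lemma IsContinuumPolyaWalk.mgf_of_neg
    (hX : IsContinuumPolyaWalk P !![-γ, -γ; γ, γ] x₀ X) (hten : Tenable !![-γ, -γ; γ, γ] x₀)
    (hγ : 0 < γ) (hx : x₀ 0 ≤ x₀ 1) (t : ℝ≥0) {u : ℝ} (hu : u < 0) :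
    mgf (fun ω => X t ω 0) P u = genFun γ (Real.exp (γ * u) - 1) t x₀ := by
  have hv : -1 < Real.exp (γ * u) - 1 := by linarith [Real.exp_pos (γ * u)]
  have hv0 : Real.exp (γ * u) - 1 ≤ 0 := by
    rw [sub_nonpos, Real.exp_le_one_iff]
    nlinarith
  have hD : 0 < 1 - γ * t * (Real.exp (γ * u) - 1) := by
    nlinarith [mul_nonneg hγ.le t.coe_nonneg]
  rw [mgf_eq_toReal_lintegral (hX.aemeasurable_coord hten hγ t 0)]
  simp_rw [exp_mul_eq_rpow hγ u]
  rw [hX.lintegral_rpow_eq hten hγ hx hv hv0, ENNReal.toReal_ofReal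
    (genFun_nonneg hD.le (one_sub_mul_add_pos hγ t.coe_nonneg hv hD).le _)]

/-- The closed form of the complex moment generating function of the first coordinate. -/
noncomputable def walkTransform (γ : ℝ) (m : ℕ) (y t : ℝ) (z : ℂ) : ℂ :=
  (1 - γ * t * (Complex.exp (γ * z) - 1) + (Complex.exp (γ * z) - 1)) ^ m /
    (1 - γ * t * (Complex.exp (γ * z) - 1)) ^ ((y / γ : ℝ) : ℂ)

lemma walkTransform_ofReal {t u y : ℝ} {m : ℕ} (hu : γ * t * (Real.exp (γ * u) - 1) < 1)
    (hm : x₀ 0 / γ = m) (hy : x₀ 1 = y) :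
    walkTransform γ m y t u = (genFun γ (Real.exp (γ * u) - 1) t x₀ : ℝ) := by
  have h := Complex.ofReal_cpow (x := 1 - γ * t * (Real.exp (γ * u) - 1)) (by linarith) (y / γ)
  rw [walkTransform, genFun, hm, hy, Real.rpow_natCast]
  push_cast at h ⊢
  rw [h]

/-- Since Re e^{γz} ≤ e^{γ Re z}, the base of the complex power stays in the right half-plane, away
from the branch cut. -/
lemma re_one_sub_pos (hγ : 0 < γ) {t : ℝ} (ht : 0 ≤ t) {z : ℂ}
    (hz : γ * t * (Real.exp (γ * z.re) - 1) < 1) :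
    0 < (1 - γ * t * (Complex.exp (γ * z) - 1)).re := by
  have h1 : (Complex.exp (γ * z)).re ≤ Real.exp (γ * z.re) := by
    refine (Complex.re_le_norm _).trans_eq ?_
    rw [Complex.norm_exp, Complex.re_ofReal_mul]
  have h2 : (γ * t * (Complex.exp (γ * z) - 1) : ℂ).re =
      γ * t * ((Complex.exp (γ * z)).re - 1) := by
    rw [← Complex.ofReal_mul, Complex.re_ofReal_mul, Complex.sub_re, Complex.one_re]
  rw [Complex.sub_re, h2, Complex.one_re]
  nlinarith [mul_nonneg hγ.le ht]

lemma differentiableAt_walkTransform (hγ : 0 < γ) (m : ℕ) (y : ℝ) {t : ℝ} (ht : 0 ≤ t) {z : ℂ}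
    (hz : γ * t * (Real.exp (γ * z.re) - 1) < 1) :
    DifferentiableAt ℂ (walkTransform γ m y t) z := by
  have h1 : (1 - γ * t * (Complex.exp (γ * z) - 1) : ℂ) ∈ Complex.slitPlane :=
    .inl (re_one_sub_pos hγ ht hz)
  unfold walkTransform
  refine DifferentiableAt.div (by fun_prop) (DifferentiableAt.cpow_const (by fun_prop) h1) ?_
  rw [Ne, Complex.cpow_eq_zero_iff]
  exact fun h => Complex.slitPlane_ne_zero h1 h.1

lemma IsContinuumPolyaWalk.complexMGF_eq
    (hX : IsContinuumPolyaWalk P !![-γ, -γ; γ, γ] x₀ X) (hten : Tenable !![-γ, -γ; γ, γ] x₀)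
    (hγ : 0 < γ) (hx : x₀ 0 ≤ x₀ 1) {m : ℕ} (hm : x₀ 0 / γ = m) (t : ℝ≥0) {z : ℂ}
    (hz : γ * t * (Real.exp (γ * z.re) - 1) < 1) :
    complexMGF (fun ω => X t ω 0) P z = walkTransform γ m (x₀ 1) t z := by
  have hneg : ∀ u : ℝ, u < 0 → γ * t * (Real.exp (γ * u) - 1) < 1 := by
    intro u hu
    have h1 : Real.exp (γ * u) ≤ 1 := Real.exp_le_one_iff.2 (by nlinarith)
    nlinarith [mul_nonneg hγ.le t.coe_nonneg]
  refine complexMGF_eqOn_of_mgf_eq (S := {u : ℝ | γ * t * (Real.exp (γ * u) - 1) < 1})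
    (isOpen_lt (by fun_prop) (by fun_prop)) ⟨fun u _ w hw s hs => ?_⟩ hneg
    (fun u hu => hX.integrable_exp hten hγ t hu) ?_ (fun u hu => ?_) hz
  · have h2 : γ * t * (Real.exp (γ * s) - 1) ≤ γ * t * (Real.exp (γ * w) - 1) := by
      have := hs.2
      gcongr
    exact h2.trans_lt hw
  · exact fun z hz =>
      (differentiableAt_walkTransform hγ m _ t.coe_nonneg hz).differentiableWithinAt
  · rw [walkTransform_ofReal (hneg u hu) hm rfl, hX.mgf_of_neg hten hγ hx t hu]

lemma IsContinuumPolyaWalk.mgf_eq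
    (hX : IsContinuumPolyaWalk P !![-γ, -γ; γ, γ] x₀ X) (hten : Tenable !![-γ, -γ; γ, γ] x₀)
    (hγ : 0 < γ) (hx : x₀ 0 ≤ x₀ 1) (t : ℝ≥0) {u : ℝ}
    (hu : γ * t * (Real.exp (γ * u) - 1) < 1) :
    mgf (fun ω => X t ω 0) P u = genFun γ (Real.exp (γ * u) - 1) t x₀ := by
  obtain ⟨m, hm⟩ := hten.exists_natCast hγ
  have h1 := hX.complexMGF_eq hten hγ hx hm t (z := u) (by simpa using hu)
  rw [complexMGF_ofReal, walkTransform_ofReal hu hm rfl] at h1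
  exact_mod_cast h1

end Walk

end Transforms

/-! ### Scaling limits and the gamma law. -/

section Limits

/-- The derivative of h ↦ e^{ch} at 0, along h = 1/t. -/
lemma tendsto_coe_mul_exp_div_sub_one (c : ℂ) :
    Tendsto (fun t : ℝ≥0 => ((t : ℝ) : ℂ) * (Complex.exp (c / (t : ℝ)) - 1)) atTop (𝓝 c) := by
  have h1 : HasDerivAt (fun h : ℝ => Complex.exp (c * h)) c 0 := by
    have h2 : HasDerivAt (fun h : ℝ => c * (h : ℂ)) c 0 := by
      simpa using (Complex.ofRealCLM.hasDerivAt (x := (0 : ℝ))).const_mul c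
    simpa using h2.cexp
  have h2 := h1.tendsto_slope_zero_right.comp
    (tendsto_inv_atTop_nhdsGT_zero.comp (NNReal.tendsto_coe_atTop.2 tendsto_id))
  refine h2.congr fun t => ?_
  simp [div_eq_mul_inv]

lemma tendsto_div_coe_nnreal (c : ℂ) :
    Tendsto (fun t : ℝ≥0 => c / ((t : ℝ) : ℂ)) atTop (𝓝 0) := by
  have h1 : Tendsto (fun t : ℝ≥0 => ((t : ℝ) : ℂ)) atTop (Bornology.cobounded ℂ) := by
    rw [← tendsto_norm_atTop_iff_cobounded]
    simpa using NNReal.tendsto_coe_atTop.2 tendsto_id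
  simpa [div_eq_mul_inv] using (tendsto_inv₀_cobounded.comp h1).const_mul c

/-- At argument c/t one has v → 0 and γtv → γ²c, so N and D share the limit 1 − γ²c; the power m =
x/γ cancels and leaves the exponent (y − x)/γ. -/
lemma tendsto_walkTransform {γ x y : ℝ} {m : ℕ} (hm : x / γ = m) {c : ℂ}
    (hc : 0 < (1 - γ ^ 2 * c : ℂ).re) :
    Tendsto (fun t : ℝ≥0 => walkTransform γ m y t (c / (t : ℝ))) atTop
      (𝓝 (1 / (1 - γ ^ 2 * c) ^ (((y - x) / γ : ℝ) : ℂ))) := by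
  have hslit : (1 - γ ^ 2 * c : ℂ) ∈ Complex.slitPlane := .inl hc
  have hne := Complex.slitPlane_ne_zero hslit
  have hv : Tendsto (fun t : ℝ≥0 => Complex.exp (γ * (c / (t : ℝ))) - 1) atTop (𝓝 0) := by
    have h1 := ((tendsto_div_coe_nnreal c).const_mul (γ : ℂ)).cexp.sub_const 1
    simpa using h1
  have hD : Tendsto (fun t : ℝ≥0 => 1 - γ * (t : ℝ) * (Complex.exp (γ * (c / (t : ℝ))) - 1)) atTop
      (𝓝 (1 - γ ^ 2 * c)) := by
    have h1 := ((tendsto_coe_mul_exp_div_sub_one (γ * c)).const_mul (γ : ℂ)).const_sub 1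
    rw [← mul_assoc, ← pow_two] at h1
    refine h1.congr fun t => ?_
    rw [mul_assoc, mul_div_assoc]
  have hN := (hD.add hv).pow m
  have hne' : (1 - γ ^ 2 * c : ℂ) ^ ((y / γ : ℝ) : ℂ) ≠ 0 := by
    rw [Ne, Complex.cpow_eq_zero_iff]
    exact fun h => hne h.1
  have hlim := hN.div (hD.cpow (tendsto_const_nhds (x := ((y / γ : ℝ) : ℂ))) hslit) hne'
  have hexp : y / γ = m + (y - x) / γ := by rw [← hm]; ring
  have heq : (1 - γ ^ 2 * c + 0 : ℂ) ^ m / (1 - γ ^ 2 * c) ^ ((y / γ : ℝ) : ℂ) =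
      1 / (1 - γ ^ 2 * c) ^ (((y - x) / γ : ℝ) : ℂ) := by
    rw [add_zero, hexp, Complex.ofReal_add, Complex.cpow_add _ _ hne, Complex.ofReal_natCast,
      Complex.cpow_natCast]
    have := pow_ne_zero m hne
    field_simp
  rw [heq] at hlim
  exact hlim

variable {Ω : Type*} [MeasurableSpace Ω] {P : Measure Ω} [IsProbabilityMeasure P] {γ : ℝ}
  {x₀ : Fin 2 → ℝ} {X : ℝ≥0 → Ω → Fin 2 → ℝ}

lemma eventually_mul_exp_lt_one {s : ℝ} (hs : γ ^ 2 * s < 1) :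
    ∀ᶠ t : ℝ≥0 in atTop, γ * t * (Real.exp (γ * (s / t)) - 1) < 1 := by
  have h1 := (Complex.continuous_re.tendsto _).comp
    ((tendsto_coe_mul_exp_div_sub_one ((γ * s : ℝ) : ℂ)).const_mul (γ : ℂ))
  have h2 : ((γ : ℂ) * ((γ * s : ℝ) : ℂ)).re < 1 := by
    rw [← Complex.ofReal_mul, Complex.ofReal_re]
    nlinarith
  filter_upwards [h1.eventually_lt_const h2] with t ht
  refine lt_of_eq_of_lt ?_ ht
  simp only [Function.comp_apply]
  rw [← Complex.ofReal_div, ← Complex.ofReal_exp, ← Complex.ofReal_one, ← Complex.ofReal_sub,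
    ← Complex.ofReal_mul, ← Complex.ofReal_mul, Complex.ofReal_re, mul_assoc, mul_div_assoc]

lemma IsContinuumPolyaWalk.tendsto_mgf_div
    (hX : IsContinuumPolyaWalk P !![-γ, -γ; γ, γ] x₀ X) (hten : Tenable !![-γ, -γ; γ, γ] x₀)
    (hγ : 0 < γ) (hx : x₀ 0 ≤ x₀ 1) {s : ℝ} (hs : γ ^ 2 * s < 1) :
    Tendsto (fun t : ℝ≥0 => mgf (fun ω => X t ω 0 / t) P s) atTop
      (𝓝 (1 / (1 - γ ^ 2 * s) ^ ((x₀ 1 - x₀ 0) / γ))) := by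
  obtain ⟨m, hm⟩ := hten.exists_natCast hγ
  have hpos : 0 < 1 - γ ^ 2 * s := by linarith
  have hcast : (1 - γ ^ 2 * s : ℂ) = ((1 - γ ^ 2 * s : ℝ) : ℂ) := by push_cast; rfl
  have h1 := (Complex.continuous_re.tendsto _).comp
    (tendsto_walkTransform (y := x₀ 1) hm (c := s) (by rw [hcast, Complex.ofReal_re]; exact hpos))
  rw [hcast, ← Complex.ofReal_cpow hpos.le, ← Complex.ofReal_one, ← Complex.ofReal_div,
    Complex.ofReal_re] at h1
  refine h1.congr' ?_
  filter_upwards [eventually_mul_exp_lt_one hs] with t ht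
  rw [Function.comp_apply, ← Complex.ofReal_div, ← hX.complexMGF_eq hten hγ hx hm t
    (by rw [Complex.ofReal_re]; exact ht), re_complexMGF_ofReal, mgf, mgf]
  refine integral_congr_ae (ae_of_all _ fun ω => ?_)
  simp only
  ring_nf

omit [IsProbabilityMeasure P] in
lemma charFun_map_add_div {Z : Ω → ℝ} (hZ : AEMeasurable Z P) (b t ξ : ℝ) :
    charFun (P.map fun ω => (Z ω + b) / t) ξ =
      Complex.exp (ξ * b * Complex.I / t) * complexMGF Z P (ξ * Complex.I / t) := by
  rw [← complexMGF_mul_I ((hZ.add_const b).div_const t), complexMGF, complexMGF,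
    ← integral_const_mul]
  refine integral_congr_ae (ae_of_all _ fun ω => ?_)
  simp only
  rw [← Complex.exp_add]
  push_cast
  ring_nf

/-- The shift b treats both coordinates at once: b = 0 for X and b = λ for Y. It only adds a phase
tending to 1. -/
lemma IsContinuumPolyaWalk.tendstoInDistribution_add_div
    (hX : IsContinuumPolyaWalk P !![-γ, -γ; γ, γ] x₀ X) (hten : Tenable !![-γ, -γ; γ, γ] x₀)
    (hγ : 0 < γ) (hx : x₀ 0 < x₀ 1) (b : ℝ)
    [hg : IsProbabilityMeasure (gammaMeasure ((x₀ 1 - x₀ 0) / γ) (1 / γ ^ 2))] :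
    TendstoInDistribution (fun (t : ℝ≥0) ω => (X t ω 0 + b) / t) atTop (id : ℝ → ℝ) (fun _ => P)
      (gammaMeasure ((x₀ 1 - x₀ 0) / γ) (1 / γ ^ 2)) := by
  obtain ⟨m, hm⟩ := hten.exists_natCast hγ
  have hZ := hX.aemeasurable_coord hten hγ
  refine ⟨fun t => ((hZ t 0).add_const b).div_const _, aemeasurable_id, ?_⟩
  -- Passing to sequences of times makes Lévy's continuity theorem applicable.
  refine tendsto_of_seq_tendsto fun u hu => ?_
  refine ProbabilityMeasure.tendsto_of_tendsto_charFun fun ξ => ?_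
  simp only [ProbabilityMeasure.coe_mk, Measure.map_id]
  have hlim : Tendsto (fun t : ℝ≥0 => charFun (P.map fun ω => (X t ω 0 + b) / t) ξ) atTop
      (𝓝 (charFun (gammaMeasure ((x₀ 1 - x₀ 0) / γ) (1 / γ ^ 2)) ξ)) := by
    have hre : (1 - γ ^ 2 * (ξ * Complex.I) : ℂ).re = 1 := by
      rw [← Complex.ofReal_pow, ← mul_assoc, ← Complex.ofReal_mul, Complex.sub_re,
        Complex.re_ofReal_mul]
      simp
    have hgamma : charFun (gammaMeasure ((x₀ 1 - x₀ 0) / γ) (1 / γ ^ 2)) ξ =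
        1 / (1 - γ ^ 2 * (ξ * Complex.I)) ^ (((x₀ 1 - x₀ 0) / γ : ℝ) : ℂ) := by
      rw [← complexMGF_id_mul_I, complexMGF_gammaMeasure (div_pos (sub_pos.2 hx) hγ)
        (by positivity) (by simp; positivity)]
      congr 3
      push_cast
      field_simp
    rw [hgamma]
    have h1 := tendsto_walkTransform (y := x₀ 1) hm (c := ξ * Complex.I) (by rw [hre]; norm_num)
    have h2 := (tendsto_div_coe_nnreal (ξ * b * Complex.I)).cexp.mul h1
    rw [Complex.exp_zero, one_mul] at h2
    refine h2.congr fun t => ?_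
    -- On the imaginary axis the closed form is valid for every t, including t = 0, where division
    -- by zero gives 0.
    have h3 : (ξ * Complex.I / (t : ℝ) : ℂ).re = 0 := by
      rw [Complex.div_ofReal_re]
      simp
    rw [charFun_map_add_div (hZ t 0), hX.complexMGF_eq hten hγ hx.le hm t (by rw [h3]; simp)]
  exact hlim.comp hu

end Limits

/-! ### Mean and variance from the cumulant generating function. -/

section Moments

variable {Ω : Type*} [MeasurableSpace Ω] {P : Measure Ω} [IsProbabilityMeasure P] {γ : ℝ}
  {x₀ : Fin 2 → ℝ} {X : ℝ≥0 → Ω → Fin 2 → ℝ}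

lemma IsContinuumPolyaWalk.zero_mem_interior
    (hX : IsContinuumPolyaWalk P !![-γ, -γ; γ, γ] x₀ X) (hten : Tenable !![-γ, -γ; γ, γ] x₀)
    (hγ : 0 < γ) (t : ℝ≥0) : 0 ∈ interior (integrableExpSet (fun ω => X t ω 0) P) := by
  have hS : IsOpen {u : ℝ | γ * t * (Real.exp (γ * u) - 1) < 1} :=
    isOpen_lt (by fun_prop) (by fun_prop)
  have h0 : (0 : ℝ) ∈ {u : ℝ | γ * t * (Real.exp (γ * u) - 1) < 1} := by simp
  exact interior_maximal (fun u hu => hX.integrable_exp hten hγ t hu) hS h0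

lemma IsContinuumPolyaWalk.eventually_cgf_eq
    (hX : IsContinuumPolyaWalk P !![-γ, -γ; γ, γ] x₀ X) (hten : Tenable !![-γ, -γ; γ, γ] x₀)
    (hγ : 0 < γ) (hx : x₀ 0 ≤ x₀ 1) (t : ℝ≥0) :
    ∀ᶠ u in 𝓝 (0 : ℝ), 0 < 1 - γ * t * (Real.exp (γ * u) - 1) ∧
      0 < 1 - γ * t * (Real.exp (γ * u) - 1) + (Real.exp (γ * u) - 1) ∧
      cgf (fun ω => X t ω 0) P u =
        x₀ 0 / γ * Real.log (1 - γ * t * (Real.exp (γ * u) - 1) + (Real.exp (γ * u) - 1)) -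
        x₀ 1 / γ * Real.log (1 - γ * t * (Real.exp (γ * u) - 1)) := by
  have hS : IsOpen {u : ℝ | γ * t * (Real.exp (γ * u) - 1) < 1} :=
    isOpen_lt (by fun_prop) (by fun_prop)
  have h0 : (0 : ℝ) ∈ {u : ℝ | γ * t * (Real.exp (γ * u) - 1) < 1} := by simp
  filter_upwards [hS.mem_nhds h0] with u hu
  have hD : 0 < 1 - γ * t * (Real.exp (γ * u) - 1) := sub_pos.2 hu
  have hN := one_sub_mul_add_pos hγ t.coe_nonneg (v := Real.exp (γ * u) - 1)
    (by linarith [Real.exp_pos (γ * u)]) hD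
  refine ⟨hD, hN, ?_⟩
  rw [cgf, hX.mgf_eq hten hγ hx t hu, genFun, Real.log_div (Real.rpow_pos_of_pos hN _).ne'
    (Real.rpow_pos_of_pos hD _).ne', Real.log_rpow hN, Real.log_rpow hD]

lemma hasDerivAt_exp_mul_sub_one (γ u : ℝ) :
    HasDerivAt (fun u => Real.exp (γ * u) - 1) (γ * Real.exp (γ * u)) u := by
  simpa [mul_comm] using (((hasDerivAt_id u).const_mul γ).exp.sub_const 1)

/-- The formula is needed on a neighbourhood of 0, not only at 0, because the variance
differentiates it once more. -/
lemma IsContinuumPolyaWalk.eventually_deriv_cgf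
    (hX : IsContinuumPolyaWalk P !![-γ, -γ; γ, γ] x₀ X) (hten : Tenable !![-γ, -γ; γ, γ] x₀)
    (hγ : 0 < γ) (hx : x₀ 0 ≤ x₀ 1) (t : ℝ≥0) :
    deriv (cgf (fun ω => X t ω 0) P) =ᶠ[𝓝 0] fun u =>
      x₀ 0 * (1 - γ * t) * Real.exp (γ * u) /
        (1 - γ * t * (Real.exp (γ * u) - 1) + (Real.exp (γ * u) - 1)) +
      x₀ 1 * (γ * t) * Real.exp (γ * u) / (1 - γ * t * (Real.exp (γ * u) - 1)) := by
  filter_upwards [(hX.eventually_cgf_eq hten hγ hx t).eventually_nhds] with u hu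
  obtain ⟨hD, hN, _⟩ := hu.self_of_nhds
  have heq : cgf (fun ω => X t ω 0) P =ᶠ[𝓝 u] fun u =>
        x₀ 0 / γ * Real.log (1 - γ * t * (Real.exp (γ * u) - 1) + (Real.exp (γ * u) - 1)) -
        x₀ 1 / γ * Real.log (1 - γ * t * (Real.exp (γ * u) - 1)) := hu.mono fun _ h => h.2.2
  have hv := hasDerivAt_exp_mul_sub_one γ u
  have hD' := (hv.const_mul (γ * t)).const_sub 1
  have hN' := hD'.add hv
  rw [heq.deriv_eq]
  refine (((hN'.log hN.ne').const_mul (x₀ 0 / γ)).sub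
    ((hD'.log hD.ne').const_mul (x₀ 1 / γ))).deriv.trans ?_
  simp only [Pi.add_apply]
  have h1 := hN.ne'
  have h2 := hD.ne'
  generalize 1 - γ * t * (Real.exp (γ * u) - 1) = D at *
  field_simp
  ring

lemma IsContinuumPolyaWalk.integral_zero
    (hX : IsContinuumPolyaWalk P !![-γ, -γ; γ, γ] x₀ X) (hten : Tenable !![-γ, -γ; γ, γ] x₀)
    (hγ : 0 < γ) (hx : x₀ 0 ≤ x₀ 1) (t : ℝ≥0) :
    ∫ ω, X t ω 0 ∂P = (x₀ 1 - x₀ 0) * γ * t + x₀ 0 := by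
  have h1 := (hX.eventually_deriv_cgf hten hγ hx t).self_of_nhds
  rw [deriv_cgf_zero (hX.zero_mem_interior hten hγ t)] at h1
  simp at h1
  rw [h1]
  ring

lemma IsContinuumPolyaWalk.variance_zero
    (hX : IsContinuumPolyaWalk P !![-γ, -γ; γ, γ] x₀ X) (hten : Tenable !![-γ, -γ; γ, γ] x₀)
    (hγ : 0 < γ) (hx : x₀ 0 ≤ x₀ 1) (t : ℝ≥0) :
    Var[fun ω => X t ω 0; P] = (x₀ 1 - x₀ 0) * γ ^ 3 * (t : ℝ) ^ 2 +
      (2 * x₀ 0 + (x₀ 1 - x₀ 0)) * γ ^ 2 * t := by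
  have hmem := hX.zero_mem_interior hten hγ t
  have h1 := iteratedDeriv_two_cgf_eq_integral hmem
  rw [deriv_cgf_zero hmem] at h1
  simp only [zero_mul, Real.exp_zero, mul_one, mgf_zero, div_one, probReal_univ] at h1
  rw [variance_eq_integral (hX.aemeasurable_coord hten hγ t 0), ← h1, iteratedDeriv_succ,
    iteratedDeriv_one, (hX.eventually_deriv_cgf hten hγ hx t).deriv_eq]
  have hv := hasDerivAt_exp_mul_sub_one γ 0
  have hw : HasDerivAt (fun u => Real.exp (γ * u)) (γ * Real.exp (γ * 0)) 0 := by
    simpa using hv.add_const 1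
  have hD' := (hv.const_mul (γ * t)).const_sub 1
  have hN' := hD'.add hv
  refine (((hw.const_mul (x₀ 0 * (1 - γ * t))).div hN' (by simp)).add
    ((hw.const_mul (x₀ 1 * (γ * t))).div hD' (by simp))).deriv.trans ?_
  simp
  ring

lemma IsContinuumPolyaWalk.memLp_two
    (hX : IsContinuumPolyaWalk P !![-γ, -γ; γ, γ] x₀ X) (hten : Tenable !![-γ, -γ; γ, γ] x₀)
    (hγ : 0 < γ) (t : ℝ≥0) : MemLp (fun ω => X t ω 0) 2 P :=
  memLp_of_mem_interior_integrableExpSet (hX.zero_mem_interior hten hγ t) 2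

end Moments

end PolyaWalk

/-! ### Assembly of the four statements. -/

theorem mainTheorem4 {Ω : Type*} [MeasurableSpace Ω] (P : Measure Ω) [IsProbabilityMeasure P]
    (γ x₀ y₀ lam : ℝ) (hγ : 0 < γ) (hlam : lam = y₀ - x₀) (hpos : 0 < lam)
    (hten : PolyaWalk.Tenable !![-γ, -γ; γ, γ] ![x₀, y₀])
    (X : ℝ≥0 → Ω → Fin 2 → ℝ)
    (hX : PolyaWalk.IsContinuumPolyaWalk P !![-γ, -γ; γ, γ] ![x₀, y₀] X) :
    -- the moment generating function of the first coordinate, in both closed forms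
    (∀ (t : ℝ≥0) (u : ℝ), γ * t * (Real.exp (γ * u) - 1) < 1 →
      Integrable (fun ω => Real.exp (u * X t ω 0)) P ∧
      mgf (fun ω => X t ω 0) P u =
        1 / (1 - γ * t * (Real.exp (γ * u) - 1)) ^ (lam / γ) *
          ((Real.exp (γ * u) - γ * t * (Real.exp (γ * u) - 1)) /
            (1 - γ * t * (Real.exp (γ * u) - 1))) ^ (x₀ / γ) ∧
      mgf (fun ω => X t ω 0) P u =
        (Real.exp (γ * u) - γ * t * (Real.exp (γ * u) - 1)) ^ (x₀ / γ) /
          (1 - γ * t * (Real.exp (γ * u) - 1)) ^ (y₀ / γ)) ∧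
    -- means and variances of both coordinates
    (∀ t : ℝ≥0,
      MemLp (fun ω => X t ω 0) 2 P ∧ MemLp (fun ω => X t ω 1) 2 P ∧
      ∫ ω, X t ω 0 ∂P = lam * γ * t + x₀ ∧
      ∫ ω, X t ω 1 ∂P = lam * γ * t + y₀ ∧
      Var[fun ω => X t ω 0; P] = lam * γ ^ 3 * (t : ℝ) ^ 2 + (2 * x₀ + lam) * γ ^ 2 * t ∧
      Var[fun ω => X t ω 1; P] = lam * γ ^ 3 * (t : ℝ) ^ 2 + (2 * x₀ + lam) * γ ^ 2 * t) ∧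
    -- the limit of the moment generating function of `X(t) / t`
    (∀ s : ℝ, γ ^ 2 * s < 1 →
      (∀ᶠ t : ℝ≥0 in atTop, Integrable (fun ω => Real.exp (s * (X t ω 0 / t))) P) ∧
      Tendsto (fun t : ℝ≥0 => mgf (fun ω => X t ω 0 / t) P s) atTop
        (𝓝 (1 / (1 - γ ^ 2 * s) ^ (lam / γ)))) ∧
    -- convergence in distribution to the gamma law of shape `lam / γ` and scale `γ ^ 2`
    -- (Mathlib's second parameter is the rate, the inverse of the scale)
    (∃ _ : IsProbabilityMeasure (gammaMeasure (lam / γ) (1 / γ ^ 2)),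
      TendstoInDistribution (fun (t : ℝ≥0) ω => X t ω 0 / t) atTop
        (id : ℝ → ℝ) (fun _ => P) (gammaMeasure (lam / γ) (1 / γ ^ 2)) ∧
      TendstoInDistribution (fun (t : ℝ≥0) ω => X t ω 1 / t) atTop
        (id : ℝ → ℝ) (fun _ => P) (gammaMeasure (lam / γ) (1 / γ ^ 2))) := by
  subst hlam
  have hx : (![x₀, y₀] : Fin 2 → ℝ) 0 < ![x₀, y₀] 1 := by simpa using hpos
  have hmgf : ∀ (t : ℝ≥0) (u : ℝ), γ * t * (Real.exp (γ * u) - 1) < 1 →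
      mgf (fun ω => X t ω 0) P u =
        (Real.exp (γ * u) - γ * t * (Real.exp (γ * u) - 1)) ^ (x₀ / γ) /
          (1 - γ * t * (Real.exp (γ * u) - 1)) ^ (y₀ / γ) := by
    intro t u hu
    rw [hX.mgf_eq hten hγ hx.le t hu, PolyaWalk.genFun]
    simp only [Matrix.cons_val_zero, Matrix.cons_val_one]
    congr 2
    ring
  have hY : ∀ t, (fun ω => X t ω 1) =ᵐ[P] fun ω => X t ω 0 + (y₀ - x₀) :=
    fun t => hX.ae_one_eq hten hγ t
  have hL2 := hX.memLp_two hten hγ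
  have hgamma : IsProbabilityMeasure (gammaMeasure ((y₀ - x₀) / γ) (1 / γ ^ 2)) :=
    isProbabilityMeasure_gammaMeasure (by positivity) (by positivity)
  have hdist : ∀ b : ℝ, TendstoInDistribution (fun (t : ℝ≥0) ω => (X t ω 0 + b) / t) atTop
      (id : ℝ → ℝ) (fun _ => P) (gammaMeasure ((y₀ - x₀) / γ) (1 / γ ^ 2)) :=
    fun b => hX.tendstoInDistribution_add_div hten hγ hx b (hg := hgamma)
  refine ⟨fun t u hu => ⟨hX.integrable_exp hten hγ t hu, ?_, hmgf t u hu⟩, fun t => ?_,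
    fun s hs => ⟨?_, hX.tendsto_mgf_div hten hγ hx.le hs⟩, hgamma, ?_, ?_⟩
  · have hD : 0 < 1 - γ * t * (Real.exp (γ * u) - 1) := sub_pos.2 hu
    have hN := PolyaWalk.one_sub_mul_add_pos hγ t.coe_nonneg (v := Real.exp (γ * u) - 1)
      (by linarith [Real.exp_pos (γ * u)]) hD
    have hN' : 0 ≤ Real.exp (γ * u) - γ * t * (Real.exp (γ * u) - 1) := by linarith
    -- Splitting the exponent of the denominator turns one closed form into the other.
    have hexp : y₀ / γ = (y₀ - x₀) / γ + x₀ / γ := by ring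
    rw [hmgf t u hu, Real.div_rpow hN' hD.le, hexp, Real.rpow_add hD]
    field_simp
  · have hint : Integrable (fun ω => X t ω 0) P := (hL2 t).integrable one_le_two
    have hmean : ∫ ω, X t ω 0 ∂P = (y₀ - x₀) * γ * t + x₀ := hX.integral_zero hten hγ hx.le t
    have hvar : Var[fun ω => X t ω 0; P] = (y₀ - x₀) * γ ^ 3 * (t : ℝ) ^ 2 +
        (2 * x₀ + (y₀ - x₀)) * γ ^ 2 * t := hX.variance_zero hten hγ hx.le t
    refine ⟨hL2 t, ((hL2 t).add (memLp_const (y₀ - x₀))).ae_eq (hY t).symm, hmean, ?_, hvar, ?_⟩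
    · rw [integral_congr_ae (hY t), integral_add hint (integrable_const _), hmean]
      simp
    · rw [variance_congr (hY t), variance_add_const hint.aestronglyMeasurable, hvar]
  · filter_upwards [PolyaWalk.eventually_mul_exp_lt_one hs] with t ht
    refine (hX.integrable_exp hten hγ t ht).congr (ae_of_all _ fun ω => ?_)
    simp only
    ring_nf
  · simpa using hdist 0
  · refine (hdist (y₀ - x₀)).congr (fun t => ?_) (ae_eq_refl _)
    filter_upwards [hY t] with ω hω
    rw [hω]
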